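/- Let $p$ be a prime, let $\mathcal F$ be a (not necessarily saturated) fusion system over a finite $p$-group $S$, and let $\mathcal E$ be an $\mathcal F$-invariant subsystem of $\mathcal F$ over a subgroup $T\le S$; that is, $\mathcal E$ is a fusion system over $T$ contained in $\mathcal F$, the subgroup $T$ is strongly closed in $\mathcal F$, every $\alpha\in\mathrm{Aut}_{\mathcal F}(T)$ satisfies ${}^{\alpha}\mathcal E=\mathcal E$, and for every $P\le T$ every $\varphi\in\mathrm{Hom}_{\mathcal F}(P,T)$ is of the form $\varphi=\alpha\circ\varphi_0$ with $\alpha\in\mathrm{Aut}_{\mathcal F}(T)$ and $\varphi_0\in\mathrm{Hom}_{\mathcal E}(P,T)$. Suppose that $\mathcal E$ is saturated. Let $\mathcal E^{cr}$ be the set of all subgroups $P\le T$ such that $C_T(Q)\le Q$ for every $\mathcal E$-conjugate $Q$ of $P$, and $O_p(N_{\mathcal E}(Q))=Q$ for every fully $\mathcal E$-normalized $\mathcal E$-conjugate $Q$ of $P$. (Here $O_p(\mathcal D)$ denotes the largest subgroup that is normal in the fusion system $\mathcal D$.) Let $\Delta$ be a set of subgroups of $S$ such that: 1. $\Delta$ is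 $\mathcal F$-closed, i.e. closed under $\mathcal F$-conjugacy and under taking overgroups in $S$; 2. $\mathcal F$ is $\Delta$-generated, i.e. every morphism of $\mathcal F$ is a product of restrictions of $\mathcal F$-morphisms between subgroups in $\Delta$; 3. $\mathcal F$ is $\Delta$-saturated, i.e. the $\mathcal F$-conjugacy class of each element of $\Delta$ contains a subgroup that is fully automized and receptive in $\mathcal F$; 4. $\mathcal E^{cr}\subseteq\Delta$. Then $\mathcal F$ is saturated, i.e. every subgroup of $S$ is $\mathcal F$-conjugate to a subgroup that is fully automized and receptive in $\mathcal F$. -/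

import Mathlib

open Subgroup

/-- `φ : P → Q` is a restriction of `ψ : P' → Q'` (all four groups being subgroups of `G`):
`P ≤ P'`, `Q ≤ Q'`, and `φ` and `ψ` agree on `P`. -/
def IsRestriction {G : Type*} [Group G] {P Q P' Q' : Subgroup G}
    (φ : P →* Q) (ψ : P' →* Q') : Prop :=
  Q ≤ Q' ∧ ∃ hP : P ≤ P', ∀ x : P, (ψ (inclusion hP x) : G) = (φ x : G)

/-- A fusion system over a subgroup `S` of an ambient group `G`. The objects are the subgroups of
`S`, i.e. the subgroups of `G` contained in `S`; the set of morphisms from `P` to `Q` is a set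
`Hom P Q` of injective group homomorphisms containing all the homomorphisms induced by conjugation
with an element of `S`, and every morphism is an isomorphism of the category followed by an
inclusion. (That `S` is a finite `p`-group is a hypothesis on `S`, imposed where it is used.) -/
structure FusionSystem {G : Type*} [Group G] (S : Subgroup G) where
  /-- the morphisms from `P` to `Q` -/
  Hom : (P Q : Subgroup G) → Set (P →* Q)
  /-- sources of morphisms are subgroups of `S` -/
  source_le : ∀ {P Q : Subgroup G} {φ : P →* Q}, φ ∈ Hom P Q → P ≤ S
  /-- targets of morphisms are subgroups of `S` -/
  target_le : ∀ {P Q : Subgroup G} {φ : P →* Q}, φ ∈ Hom P Q → Q ≤ S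
  /-- morphisms are injective -/
  injective : ∀ {P Q : Subgroup G} {φ : P →* Q}, φ ∈ Hom P Q → Function.Injective φ
  /-- conjugation by an element of `S` is a morphism (`g = 1` gives identities and inclusions) -/
  conj_mem : ∀ {P Q : Subgroup G}, P ≤ S → Q ≤ S → ∀ g ∈ S, ∀ φ : P →* Q,
    (∀ x : P, (φ x : G) = g * (x : G) * g⁻¹) → φ ∈ Hom P Q
  /-- morphisms compose -/
  comp_mem : ∀ {P Q R : Subgroup G} {φ : P →* Q} {ψ : Q →* R},
    φ ∈ Hom P Q → ψ ∈ Hom Q R → ψ.comp φ ∈ Hom P R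
  /-- every morphism is an isomorphism of the category followed by an inclusion -/
  exists_iso : ∀ {P Q : Subgroup G} {φ : P →* Q}, φ ∈ Hom P Q →
    ∃ (R : Subgroup G) (hR : R ≤ Q) (e : P ≃* R), e.toMonoidHom ∈ Hom P R ∧
      e.symm.toMonoidHom ∈ Hom R P ∧ φ = (inclusion hR).comp e.toMonoidHom

/-- `Aut_S(P)`: the automorphisms of `P` induced by conjugation with elements of `N_S(P)`. -/
def autS {G : Type*} [Group G] (S P : Subgroup G) : Subgroup (MulAut P) :=
  (S.subgroupOf (normalizer (P : Set G))).map P.normalizerMonoidHom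

/-- For an isomorphism `e : Q ≃* P`, the group
`N_e = {g ∈ N_S(Q) | e ∘ c_g ∘ e⁻¹ ∈ Aut_S(P)}`. -/
def extender {G : Type*} [Group G] (S : Subgroup G) {Q P : Subgroup G} (e : Q ≃* P) :
    Subgroup G :=
  S ⊓ ((((autS S P).comap (MulAut.congr e).toMonoidHom).comap
    Q.normalizerMonoidHom).map (normalizer (Q : Set G)).subtype)

namespace FusionSystem

variable {G : Type*} [Group G] {S : Subgroup G}

/-- The isomorphisms of the category `F` from `P` to `Q`. -/
def Iso (F : FusionSystem S) (P Q : Subgroup G) : Set (P ≃* Q) :=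
  {e | e.toMonoidHom ∈ F.Hom P Q ∧ e.symm.toMonoidHom ∈ F.Hom Q P}

/-- `P` and `Q` are `F`-conjugate: they are isomorphic objects of `F`. -/
def IsConj (F : FusionSystem S) (P Q : Subgroup G) : Prop :=
  (F.Iso P Q).Nonempty

theorem id_mem (F : FusionSystem S) {P : Subgroup G} (hP : P ≤ S) :
    MonoidHom.id P ∈ F.Hom P P :=
  F.conj_mem hP hP 1 S.one_mem _ (by simp)

/-- `Aut_F(P)`, for an object `P` of `F`. -/
def aut (F : FusionSystem S) (P : Subgroup G) (hP : P ≤ S) : Subgroup (MulAut P) where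
  carrier := {α | α ∈ F.Iso P P}
  one_mem' := ⟨F.id_mem hP, F.id_mem hP⟩
  mul_mem' := fun ha hb => ⟨F.comp_mem hb.1 ha.1, F.comp_mem ha.2 hb.2⟩
  inv_mem' := fun ha => ⟨ha.2, ha.1⟩

/-- `P` is fully automized in `F`: `Aut_S(P)` is a Sylow `p`-subgroup of `Aut_F(P)`. -/
def FullyAutomized (F : FusionSystem S) (p : ℕ) (P : Subgroup G) : Prop :=
  ∃ hP : P ≤ S, ∃ A : Sylow p (F.aut P hP),
    (A : Subgroup (F.aut P hP)).map (F.aut P hP).subtype = autS S P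

/-- `P` is receptive in `F`: each isomorphism `e : Q → P` of `F` extends to a morphism
`N_e → S` of `F`. -/
def Receptive (F : FusionSystem S) (P : Subgroup G) : Prop :=
  P ≤ S ∧ ∀ (Q : Subgroup G), ∀ e ∈ F.Iso Q P,
    ∃ ψ ∈ F.Hom (extender S e) S, IsRestriction e.toMonoidHom ψ

/-- `F` is saturated: every subgroup of `S` is `F`-conjugate to a subgroup that is fully automized
and receptive in `F`. -/
def IsSaturated (F : FusionSystem S) (p : ℕ) : Prop :=
  ∀ P ≤ S, ∃ Q, F.IsConj P Q ∧ F.FullyAutomized p Q ∧ F.Receptive Q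

/-- `P` is fully `F`-normalized: `|N_S(P)| ≥ |N_S(Q)|` for every `F`-conjugate `Q` of `P`. -/
def FullyNormalized (F : FusionSystem S) (P : Subgroup G) : Prop :=
  P ≤ S ∧ ∀ Q, F.IsConj P Q →
    Nat.card (S ⊓ normalizer (Q : Set G) : Subgroup G) ≤
      Nat.card (S ⊓ normalizer (P : Set G) : Subgroup G)

/-- `P` is `F`-centric: `C_S(Q) ≤ Q` for every `F`-conjugate `Q` of `P`. -/
def IsCentric (F : FusionSystem S) (P : Subgroup G) : Prop :=
  P ≤ S ∧ ∀ Q, F.IsConj P Q → S ⊓ centralizer (Q : Set G) ≤ Q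

/-- `Q` is normal in `F`: `Q` is a normal subgroup of `S` and every morphism `P → R` of `F` extends
to a morphism `PQ → RQ` of `F` that maps `Q` onto `Q`. -/
def IsNormal (F : FusionSystem S) (Q : Subgroup G) : Prop :=
  Q ≤ S ∧ S ≤ normalizer (Q : Set G) ∧ ∀ (P R : Subgroup G), ∀ φ ∈ F.Hom P R,
    ∃ ψ ∈ F.Hom (P ⊔ Q) (R ⊔ Q), IsRestriction φ ψ ∧
      ∃ α : Q ≃* Q, IsRestriction α.toMonoidHom ψ

/-- `R = O_p(F)`: `R` is the largest subgroup of `S` that is normal in `F`. -/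
def IsOp (F : FusionSystem S) (R : Subgroup G) : Prop :=
  IsGreatest {Q : Subgroup G | F.IsNormal Q} R

/-- `N_F(Q)`, for an object `Q` of `F`: the fusion system over `N_S(Q)` whose morphisms are the
morphisms `P → R` of `F` between subgroups of `N_S(Q)` that extend to a morphism `PQ → RQ` of `F`
mapping `Q` onto `Q`. -/
def normalizerSystem (F : FusionSystem S) (Q : Subgroup G) (hQ : Q ≤ S) :
    FusionSystem (S ⊓ normalizer (Q : Set G)) where
  Hom P R := {φ | P ≤ S ⊓ normalizer (Q : Set G) ∧ R ≤ S ⊓ normalizer (Q : Set G) ∧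
    φ ∈ F.Hom P R ∧ ∃ ψ ∈ F.Hom (P ⊔ Q) (R ⊔ Q), IsRestriction φ ψ ∧
      ∃ α : Q ≃* Q, IsRestriction α.toMonoidHom ψ}
  source_le h := h.1
  target_le h := h.2.1
  injective h := F.injective h.2.2.1
  conj_mem := by
    intro P R hP hR g hg φ hφ
    have hgQ := mem_normalizer_iff.1 hg.2
    refine ⟨hP, hR, F.conj_mem (hP.trans inf_le_left) (hR.trans inf_le_left) g hg.1 φ hφ, ?_⟩
    have hmap : P ⊔ Q ≤ (R ⊔ Q).comap (MulAut.conj g).toMonoidHom := by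
      refine sup_le (fun x hx => ?_) (fun x hx => ?_)
      · have h1 := hφ ⟨x, hx⟩
        have h2 : g * x * g⁻¹ ∈ R := h1 ▸ (φ ⟨x, hx⟩).2
        exact (le_sup_left : R ≤ R ⊔ Q) h2
      · exact (le_sup_right : Q ≤ R ⊔ Q) ((hgQ x).1 hx)
    let ψ : (P ⊔ Q : Subgroup G) →* (R ⊔ Q : Subgroup G) :=
      ((MulAut.conj g).toMonoidHom.comp (P ⊔ Q).subtype).codRestrict (R ⊔ Q)
        (fun x => hmap x.2)
    refine ⟨ψ, F.conj_mem (sup_le (hP.trans inf_le_left) hQ) (sup_le (hR.trans inf_le_left) hQ)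
      g hg.1 ψ (fun x => rfl), ⟨le_sup_left, le_sup_left, fun x => (hφ x).symm⟩,
      Q.normalizerMonoidHom ⟨g, hg.2⟩, le_sup_right, le_sup_right, fun x => rfl⟩
  comp_mem := by
    rintro P R R' φ φ' ⟨hP, _, hφ, ψ, hψ, ⟨_, h1, h2⟩, α, _, h3, h4⟩
      ⟨_, hR', hφ', ψ', hψ', ⟨_, h1', h2'⟩, α', _, h3', h4'⟩
    refine ⟨hP, hR', F.comp_mem hφ hφ', ψ'.comp ψ, F.comp_mem hψ hψ',
      ⟨le_sup_left, le_sup_left, fun x => ?_⟩, α.trans α', le_sup_right, le_sup_right,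
      fun x => ?_⟩
    · have h : ψ (inclusion h1 x) = inclusion h1' (φ x) := Subtype.ext (h2 x)
      exact (congrArg (fun y => (ψ' y : G)) h).trans (h2' (φ x))
    · have h : ψ (inclusion h3 x) = inclusion h3' (α x) := Subtype.ext (h4 x)
      exact (congrArg (fun y => (ψ' y : G)) h).trans (h4' (α x))
  exists_iso := by
    rintro P R φ ⟨hP, hR, hφ, ψ, hψ, ⟨_, h1, h2⟩, α, _, h3, h4⟩
    obtain ⟨P', hP'R, e, he, he', rfl⟩ := F.exists_iso hφ
    obtain ⟨M, hM, f, hf, hf', rfl⟩ := F.exists_iso hψ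
    replace h2 : ∀ x : P, (f (inclusion h1 x) : G) = e x := h2
    replace h4 : ∀ x : Q, (f (inclusion h3 x) : G) = α x := h4
    have hM' : M = P' ⊔ Q := by
      apply le_antisymm
      · have hle : P ⊔ Q ≤ ((P' ⊔ Q).comap (M.subtype.comp f.toMonoidHom)).map
            (P ⊔ Q).subtype := by
          refine sup_le (fun x hx => ?_) (fun x hx => ?_)
          · refine ⟨inclusion h1 ⟨x, hx⟩, ?_, rfl⟩
            change (f (inclusion h1 ⟨x, hx⟩) : G) ∈ P' ⊔ Q
            rw [h2]
            exact (le_sup_left : P' ≤ P' ⊔ Q) (e ⟨x, hx⟩).2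
          · refine ⟨inclusion h3 ⟨x, hx⟩, ?_, rfl⟩
            change (f (inclusion h3 ⟨x, hx⟩) : G) ∈ P' ⊔ Q
            rw [h4]
            exact (le_sup_right : Q ≤ P' ⊔ Q) (α ⟨x, hx⟩).2
        intro m hm
        obtain ⟨z, hz, hz'⟩ := hle (f.symm ⟨m, hm⟩).2
        have : z = f.symm ⟨m, hm⟩ := Subtype.ext hz'
        subst this
        have h : ((f (f.symm ⟨m, hm⟩) : M) : G) ∈ P' ⊔ Q := hz
        rwa [f.apply_symm_apply] at h
      · refine sup_le (fun x hx => ?_) (fun x hx => ?_)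
        · have h := h2 (e.symm ⟨x, hx⟩)
          rw [e.apply_symm_apply] at h
          exact (show (_ : G) = x from h) ▸ (f _).2
        · have h := h4 (α.symm ⟨x, hx⟩)
          rw [α.apply_symm_apply] at h
          exact (show (_ : G) = x from h) ▸ (f _).2
    subst hM'
    refine ⟨P', hP'R, e, ⟨hP, hP'R.trans hR, he, f.toMonoidHom, hf,
      ⟨le_sup_left, le_sup_left, h2⟩, α, le_sup_right, le_sup_right, h4⟩,
      ⟨hP'R.trans hR, hP, he', f.symm.toMonoidHom, hf',
      ⟨le_sup_left, le_sup_left, fun x => ?_⟩, α.symm, le_sup_right, le_sup_right,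
      fun x => ?_⟩, rfl⟩
    · have h : inclusion le_sup_left x = f (inclusion h1 (e.symm x)) :=
        Subtype.ext ((h2 (e.symm x)).trans (by simp)).symm
      change ((f.symm (inclusion le_sup_left x) : (P ⊔ Q : Subgroup G)) : G) = e.symm x
      rw [h, f.symm_apply_apply]; rfl
    · have h : inclusion le_sup_right x = f (inclusion h3 (α.symm x)) :=
        Subtype.ext ((h4 (α.symm x)).trans (by simp)).symm
      change ((f.symm (inclusion le_sup_right x) : (P ⊔ Q : Subgroup G)) : G) = α.symm x
      rw [h, f.symm_apply_apply]; rfl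

/-- The set `F^{cr}` of subgroups of `S` that are centric radical in `F`: `P` is centric, and
`O_p(N_F(Q)) = Q` for every fully `F`-normalized `F`-conjugate `Q` of `P`. -/
def centricRadical (F : FusionSystem S) : Set (Subgroup G) :=
  {P | F.IsCentric P ∧ ∀ (Q : Subgroup G) (hQ : Q ≤ S), F.IsConj P Q → F.FullyNormalized Q →
    (F.normalizerSystem Q hQ).IsOp Q}

/-- `Δ` is an `F`-closed set of subgroups of `S`: it is closed under `F`-conjugacy and under
taking overgroups in `S`. -/
def IsClosedSet (F : FusionSystem S) (Δ : Set (Subgroup G)) : Prop :=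
  (∀ P ∈ Δ, P ≤ S) ∧ (∀ P ∈ Δ, ∀ Q, F.IsConj P Q → Q ∈ Δ) ∧
    (∀ P ∈ Δ, ∀ Q, P ≤ Q → Q ≤ S → Q ∈ Δ)

/-- The homomorphisms that are products of restrictions of `F`-morphisms between members
of `Δ`. -/
inductive ProductOfRestrictions (F : FusionSystem S) (Δ : Set (Subgroup G)) :
    ∀ {P Q : Subgroup G}, (P →* Q) → Prop
  | restriction {P Q R R' : Subgroup G} {φ : P →* Q} {ψ : R →* R'} (hR : R ∈ Δ) (hR' : R' ∈ Δ)
      (hψ : ψ ∈ F.Hom R R') (h : IsRestriction φ ψ) : ProductOfRestrictions F Δ φ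
  | comp {P Q R : Subgroup G} {φ : P →* Q} {ψ : Q →* R} (hφ : ProductOfRestrictions F Δ φ)
      (hψ : ProductOfRestrictions F Δ ψ) : ProductOfRestrictions F Δ (ψ.comp φ)

/-- `F` is `Δ`-generated: every morphism of `F` is a product of restrictions of `F`-morphisms
between members of `Δ`. -/
def IsGeneratedBy (F : FusionSystem S) (Δ : Set (Subgroup G)) : Prop :=
  ∀ (P Q : Subgroup G), ∀ φ ∈ F.Hom P Q, F.ProductOfRestrictions Δ φ

/-- `F` is `Δ`-saturated: the `F`-conjugacy class of every member of `Δ` contains a subgroup that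
is fully automized and receptive in `F`. -/
def IsSaturatedOn (F : FusionSystem S) (p : ℕ) (Δ : Set (Subgroup G)) : Prop :=
  ∀ P ∈ Δ, ∃ Q, F.IsConj P Q ∧ F.FullyAutomized p Q ∧ F.Receptive Q

/-- `E`, a fusion system over `T`, is a subsystem of `F`. -/
def IsSubsystem {T : Subgroup G} (E : FusionSystem T) (F : FusionSystem S) : Prop :=
  T ≤ S ∧ ∀ P Q : Subgroup G, E.Hom P Q ⊆ F.Hom P Q

/-- `T` is strongly closed in `F`: every `F`-morphism maps elements of `T` to elements of `T`. -/
def StronglyClosed (F : FusionSystem S) (T : Subgroup G) : Prop :=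
  T ≤ S ∧ ∀ (P Q : Subgroup G), ∀ φ ∈ F.Hom P Q, ∀ x : P, (x : G) ∈ T → (φ x : G) ∈ T

/-- `E`, a fusion system over `T`, is an `F`-invariant subsystem of `F`: it is a subsystem, `T` is
strongly closed in `F`, every `α ∈ Aut_F(T)` satisfies `α E α⁻¹ = E` (invariance condition), and
every `φ ∈ Hom_F(P, T)` with `P ≤ T` is `α ∘ φ₀` for some `α ∈ Aut_F(T)` and `φ₀ ∈ Hom_E(P, T)`
(Frattini condition).

In the invariance condition `a : P ≃* P'` and `b : Q ≃* Q'` are restrictions of `α`, so that `P'`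
and `Q'` are the images of `P` and `Q` under `α`. -/
def IsInvariantSubsystem {T : Subgroup G} (E : FusionSystem T) (F : FusionSystem S) : Prop :=
  E.IsSubsystem F ∧ F.StronglyClosed T ∧
  (∀ α ∈ F.Iso T T, ∀ (P P' Q Q' : Subgroup G) (a : P ≃* P') (b : Q ≃* Q'),
    IsRestriction a.toMonoidHom α.toMonoidHom → IsRestriction b.toMonoidHom α.toMonoidHom →
    ∀ φ : P →* Q, φ ∈ E.Hom P Q ↔
      (b.toMonoidHom.comp φ).comp a.symm.toMonoidHom ∈ E.Hom P' Q') ∧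
  (∀ P ≤ T, ∀ φ ∈ F.Hom P T, ∃ α ∈ F.Iso T T, ∃ φ₀ ∈ E.Hom P T, φ = α.toMonoidHom.comp φ₀)

end FusionSystem

/-! ### Finite groups: p-cores and Sylow subgroups of subgroups -/

section Groups

variable {M M' : Type*} [Group M] [Group M'] {p : ℕ}

/-! Suppose `F` is not saturated, and among the subgroups whose class is not saturated take `P` with
`|P ∩ T|`, and then `|P|`, as large as possible. Every class with larger `|R ∩ T|`, and every class
of a proper overgroup of a conjugate of `P`, is then saturated. No conjugate of `P` lies in `Δ`, and
since `Δ` is closed under overgroups and contains `E^{cr}`, the group `P ∩ T` is not in `E^{cr}`.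
Let `K_X` (`coreIn`) be the preimage in `N_S(X)` of `O_p(Aut_F(X))`; it contains `X`. Two statements
then contradict each other.

(a) `IsInvariantSubsystem.exists_coreIn_not_le`: choosing `P` in its class with `|N_S(P)|`, then
`|N_T(P ∩ T)|`, largest, some conjugate `W` with `|N_S(W)|` still largest has `K_W` not contained in
`W`. Saturation of `E` provides an `E`-conjugate of `P ∩ T` with noninner `p`-core in `E`;
maximality transports this to `W ∩ T`. The elements so obtained act on `W` inside a normal
`p`-subgroup of `Aut_F(W)`, namely the automorphisms trivial on `W/(W ∩ T)` that act on `W ∩ T`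
through `O_p(Aut_E(W ∩ T))`.

(b) `isSaturatedAt_of_lt_coreIn`: if no conjugate of `P` is in `Δ`, all proper overgroups of
conjugates have saturated classes, `|N_S(P)|` is largest and `K_P` is not contained in `P`, then the
class of `P` is saturated. By `Δ`-generation, morphisms on the class are composites of restrictions
from strictly larger subgroups. A diamond argument (`exists_arrow_of_mapsOnto`) shows that every
conjugate `Q` admits an isomorphism to `P` extending to `N_S(Q)`, and a parallel argument
(`extendsTo_coreIn`) that every automorphism of `P` extends to `K_P`. As `K_P` is strictly larger
than `P`, its class is saturated, and its full automization and receptivity descend to a suitable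
conjugate of `P`.

The technical device is a well placed pair `(R, Z)`: isomorphisms onto `R` carrying `X` to `Z` can
be corrected, by Sylow's theorem in the stabilizer of `Z` in `Aut_F(R)`, so as to extend to a
normalizer. -/

theorem mem_normalizer_of_conj_mem {P : Subgroup M} [Finite P] {g : M}
    (h : ∀ x ∈ P, g * x * g⁻¹ ∈ P) : g ∈ normalizer (P : Set M) := by
  have : Finite (P : Set M) := ‹Finite P›
  exact mem_normalizer_fintype h

theorem exists_mem_normalizer_of_lt [Fact p.Prime] {P H : Subgroup M} [Finite H]
    (hp : IsPGroup p H) (h : P < H) : ∃ m ∈ H, m ∉ P ∧ m ∈ normalizer (P : Set M) := by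
  have := hp.isNilpotent
  have hlt : P.subgroupOf H < ⊤ := by
    rw [lt_top_iff_ne_top, Ne, subgroupOf_eq_top]
    exact not_le_of_gt h
  obtain ⟨m, hm, hm'⟩ := SetLike.exists_of_lt (Group.normalizerCondition_of_isNilpotent _ hlt)
  refine ⟨m, m.2, fun h' => hm' (mem_subgroupOf.2 h'), ?_⟩
  have : Finite P := Finite.of_injective _ (inclusion_injective h.le)
  refine mem_normalizer_of_conj_mem fun x hx => ?_
  have := (mem_normalizer_iff.1 hm ⟨x, h.le hx⟩).1 (mem_subgroupOf.2 hx)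
  exact mem_subgroupOf.1 this

/-- The largest normal `p`-subgroup of a subgroup `A`. -/
def pCore (p : ℕ) (A : Subgroup M) : Subgroup M :=
  (sSup {N : Subgroup A | N.Normal ∧ IsPGroup p N}).map A.subtype

theorem pCore_le (A : Subgroup M) : pCore p A ≤ A := by
  rintro _ ⟨a, -, rfl⟩
  exact a.2

theorem isPGroup_pCore (A : Subgroup M) : IsPGroup p (pCore p A) := by
  refine IsPGroup.map ?_ _
  have : ∀ N : {N : Subgroup A | N.Normal ∧ IsPGroup p N}, (N : Subgroup A).Normal :=
    fun N => N.2.1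
  rw [sSup_eq_iSup']
  exact Sylow.iSup_of_normal _ fun N => N.2.2

theorem mem_pCore_of_mem {A N : Subgroup M} (hNA : N ≤ A)
    (hn : ∀ g ∈ A, ∀ n ∈ N, g * n * g⁻¹ ∈ N) (hp : IsPGroup p N) {a : M} (ha : a ∈ N) :
    a ∈ pCore p A := by
  refine ⟨⟨a, hNA ha⟩, ?_, rfl⟩
  have hle : N.subgroupOf A ≤ sSup {N : Subgroup A | N.Normal ∧ IsPGroup p N} := by
    refine le_sSup ⟨⟨fun n hn' g => ?_⟩, ?_⟩
    · exact mem_subgroupOf.2 (hn g g.2 n (mem_subgroupOf.1 hn'))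
    · exact hp.of_equiv (subgroupOfEquivOfLe hNA).symm
  exact hle (mem_subgroupOf.2 ha)

theorem conj_mem_pCore {A : Subgroup M} {g n : M} (hg : g ∈ A) (hn : n ∈ pCore p A) :
    g * n * g⁻¹ ∈ pCore p A := by
  obtain ⟨n, hn, rfl⟩ := hn
  have : ∀ N : {N : Subgroup A | N.Normal ∧ IsPGroup p N}, (N : Subgroup A).Normal :=
    fun N => N.2.1
  have hN : (sSup {N : Subgroup A | N.Normal ∧ IsPGroup p N}).Normal := by
    rw [sSup_eq_iSup']
    infer_instance
  exact ⟨⟨g, hg⟩ * n * ⟨g, hg⟩⁻¹, hN.conj_mem n hn _, rfl⟩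

theorem map_mem_pCore {A : Subgroup M} {A' : Subgroup M'} (φ : M ≃* M')
    (h : ∀ a, a ∈ A ↔ φ a ∈ A') {a : M} (ha : a ∈ pCore p A) : φ a ∈ pCore p A' := by
  refine mem_pCore_of_mem (N := (pCore p A).map φ.toMonoidHom) ?_ ?_
    ((isPGroup_pCore A).map _) ⟨a, ha, rfl⟩
  · rintro _ ⟨b, hb, rfl⟩
    exact (h b).1 (pCore_le A hb)
  · rintro g hg _ ⟨b, hb, rfl⟩
    refine ⟨φ.symm g * b * (φ.symm g)⁻¹, conj_mem_pCore ((h _).2 (by simpa using hg)) hb, ?_⟩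
    simp

/-- `W` is a Sylow `p`-subgroup of `H`. -/
def IsSylowIn (p : ℕ) (W H : Subgroup M) : Prop :=
  W ≤ H ∧ IsPGroup p W ∧ ¬ p ∣ W.relIndex H

theorem Sylow.isSylowIn [Fact p.Prime] {H : Subgroup M} [Finite H] (A : Sylow p H) :
    IsSylowIn p ((A : Subgroup H).map H.subtype) H := by
  refine ⟨map_subtype_le _, A.isPGroup'.map _, ?_⟩
  have : ((A : Subgroup H).map H.subtype).subgroupOf H = A := by
    rw [subgroupOf, comap_map_eq_self_of_injective H.subtype_injective]
  rw [relIndex, this]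
  exact A.not_dvd_index

theorem IsSylowIn.exists_sylow [Fact p.Prime] {W H : Subgroup M} [Finite H]
    (h : IsSylowIn p W H) : ∃ A : Sylow p H, (A : Subgroup H) = W.subgroupOf H ∧
      (A : Subgroup H).map H.subtype = W := by
  have hp : IsPGroup p (W.subgroupOf H) := h.2.1.of_equiv (subgroupOfEquivOfLe h.1).symm
  refine ⟨hp.toSylow h.2.2, rfl, ?_⟩
  exact map_subgroupOf_eq_of_le h.1

theorem IsSylowIn.exists_conj_mem [Fact p.Prime] {W H B : Subgroup M} [Finite H]
    (h : IsSylowIn p W H) (hB : B ≤ H) (hBp : IsPGroup p B) :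
    ∃ g ∈ H, ∀ b ∈ B, g * b * g⁻¹ ∈ W := by
  obtain ⟨A, hA, -⟩ := h.exists_sylow
  have hp : IsPGroup p (B.subgroupOf H) := hBp.of_equiv (subgroupOfEquivOfLe hB).symm
  obtain ⟨C, hC⟩ := hp.exists_le_sylow
  obtain ⟨g, hg⟩ := MulAction.exists_smul_eq H C A
  refine ⟨g, g.2, fun b hb => ?_⟩
  have h1 : (⟨b, hB hb⟩ : H) ∈ C := hC (mem_subgroupOf.2 hb)
  have h2 : g * ⟨b, hB hb⟩ * g⁻¹ ∈ (g • C : Sylow p H) :=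
    smul_mem_pointwise_smul (⟨b, hB hb⟩ : H) (MulAut.conj g) (C : Subgroup H) h1
  rw [hg] at h2
  have h3 : g * ⟨b, hB hb⟩ * g⁻¹ ∈ (A : Subgroup H) := h2
  rw [hA] at h3
  exact mem_subgroupOf.1 h3

theorem exists_isSylowIn [Fact p.Prime] {H : Subgroup M} [Finite H] : ∃ W, IsSylowIn p W H :=
  ⟨_, (default : Sylow p H).isSylowIn⟩

theorem IsSylowIn.mono {W L H : Subgroup M} (h : IsSylowIn p W H)
    (hWL : W ≤ L) (hLH : L ≤ H) : IsSylowIn p W L := by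
  refine ⟨hWL, h.2.1, fun hd => h.2.2 ?_⟩
  rw [← relIndex_mul_relIndex W L H hWL hLH]
  exact hd.mul_right _

theorem IsSylowIn.eq_of_le [Fact p.Prime] {W V H : Subgroup M} [Finite H]
    (h : IsSylowIn p W H) (hWV : W ≤ V) (hVH : V ≤ H) (hV : IsPGroup p V) : V = W := by
  obtain ⟨A, hA, hAW⟩ := h.exists_sylow
  have hp : IsPGroup p (V.subgroupOf H) := hV.of_equiv (subgroupOfEquivOfLe hVH).symm
  have := A.is_maximal' hp (hA ▸ comap_mono hWV)
  rw [← map_subgroupOf_eq_of_le hVH, this, hAW]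

/-- Sylow's theorem inside the group `W N`: the conjugating element is `w n`, and its factor `w`
normalizes `W`, so `n` alone suffices. In the application `N` consists of the automorphisms trivial
on `Z`, so the correction does not disturb the action on `Z`. -/
theorem IsSylowIn.exists_conj_mem_of_mem_sup [Fact p.Prime] {W H N B : Subgroup M} [Finite H]
    (h : IsSylowIn p W H) (hNH : N ≤ H) (hN : ∀ g ∈ H, ∀ n ∈ N, g * n * g⁻¹ ∈ N)
    (hBp : IsPGroup p B) (hB : ∀ b ∈ B, ∃ w ∈ W, ∃ n ∈ N, b = w * n) :
    ∃ g ∈ N, ∀ b ∈ B, g * b * g⁻¹ ∈ W := by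
  let L : Subgroup M :=
    { carrier := {x | ∃ w ∈ W, ∃ n ∈ N, x = w * n}
      one_mem' := ⟨1, W.one_mem, 1, N.one_mem, by simp⟩
      mul_mem' := by
        rintro _ _ ⟨w, hw, n, hn, rfl⟩ ⟨v, hv, m, hm, rfl⟩
        have := hN v⁻¹ (H.inv_mem (h.1 hv)) n hn
        exact ⟨w * v, W.mul_mem hw hv, _, N.mul_mem this hm, by group⟩
      inv_mem' := by
        rintro _ ⟨w, hw, n, hn, rfl⟩
        exact ⟨w⁻¹, W.inv_mem hw, _, hN w (h.1 hw) _ (N.inv_mem hn), by group⟩ }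
  have hLH : L ≤ H := by
    rintro _ ⟨w, hw, n, hn, rfl⟩
    exact H.mul_mem (h.1 hw) (hNH hn)
  have : Finite L := Finite.of_injective _ (inclusion_injective hLH)
  have hWL : IsSylowIn p W L := h.mono (fun w hw => ⟨w, hw, 1, N.one_mem, by simp⟩) hLH
  obtain ⟨_, ⟨w, hw, n, hn, rfl⟩, hg⟩ := hWL.exists_conj_mem (B := B) (fun b hb => hB b hb) hBp
  refine ⟨n, hn, fun b hb => ?_⟩
  have := W.mul_mem (W.mul_mem (W.inv_mem hw) (hg b hb)) hw
  convert this using 1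
  group

/-- A normal subgroup `O` of `H` that is a `p`-group modulo a normal subgroup `N` of `H` is
contained in the product of `N` with any Sylow `p`-subgroup of `H`. -/
theorem IsSylowIn.exists_eq_mul [Fact p.Prime] {W H N O : Subgroup M} [Finite H]
    (h : IsSylowIn p W H) (hN : ∀ g ∈ H, ∀ n ∈ N, g * n * g⁻¹ ∈ N)
    (hOH : O ≤ H) (hO : ∀ g ∈ H, ∀ n ∈ O, g * n * g⁻¹ ∈ O)
    (hp : ∀ a ∈ O, ∃ k : ℕ, a ^ p ^ k ∈ N) {a : M} (ha : a ∈ O) :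
    ∃ w ∈ W, ∃ n ∈ N, a = w * n := by
  obtain ⟨A, hA, -⟩ := h.exists_sylow
  have : (N.subgroupOf H).Normal :=
    ⟨fun n hn g => mem_subgroupOf.2 (hN g g.2 n (mem_subgroupOf.1 hn))⟩
  have : (O.subgroupOf H).Normal :=
    ⟨fun n hn g => mem_subgroupOf.2 (hO g g.2 n (mem_subgroupOf.1 hn))⟩
  let f := QuotientGroup.mk' (N.subgroupOf H)
  have hf : Function.Surjective f := QuotientGroup.mk'_surjective _
  have : ((O.subgroupOf H).map f).Normal := Normal.map inferInstance f hf
  have hOp : IsPGroup p ((O.subgroupOf H).map f) := by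
    rintro ⟨_, b, hb, rfl⟩
    obtain ⟨k, hk⟩ := hp b (mem_subgroupOf.1 hb)
    refine ⟨k, Subtype.ext ?_⟩
    change f b ^ p ^ k = 1
    rw [← map_pow]
    exact (QuotientGroup.eq_one_iff _).2 (mem_subgroupOf.2 (by simpa using hk))
  -- The image of `O` in `H / N` is a normal `p`-subgroup, hence lies in every Sylow subgroup, in
  -- particular in the image of `W`.
  have hle := hOp.le_sylow_of_normal (A.mapSurjective hf)
  obtain ⟨w, hw, hwa⟩ := hle ⟨⟨a, hOH ha⟩, mem_subgroupOf.2 ha, rfl⟩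
  have hw' : w ∈ W.subgroupOf H := hA ▸ hw
  refine ⟨w, mem_subgroupOf.1 hw', (w : M)⁻¹ * a, ?_, by group⟩
  exact mem_subgroupOf.1 (QuotientGroup.eq.1 hwa)

theorem exists_forall_le_of_bdd {α : Type*} {q : α → Prop} (hq : ∃ a, q a) (m : α → ℕ) (b : ℕ)
    (hb : ∀ a, q a → m a ≤ b) : ∃ a, q a ∧ ∀ a', q a' → m a' ≤ m a := by
  obtain ⟨a, ha⟩ := hq
  have hfin : (m '' {a | q a}).Finite := (Set.finite_Iic b).subset (by
    rintro _ ⟨a, ha, rfl⟩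
    exact hb a ha)
  obtain ⟨_, ⟨a, ha, rfl⟩, h⟩ := Set.exists_max_image _ id hfin ⟨_, a, ha, rfl⟩
  exact ⟨a, ha, fun a' ha' => h _ ⟨a', ha', rfl⟩⟩

end Groups

/-! ### Morphisms as functions on the ambient group; receptivity -/

namespace FusionSystem

variable {G : Type*} [Group G] {S : Subgroup G} {F : FusionSystem S}

/-- The function `f` restricts to an isomorphism `P ≃* Q` of the fusion system `F`. -/
def MapsOnto (F : FusionSystem S) (f : G → G) (P Q : Subgroup G) : Prop :=
  ∃ e ∈ F.Iso P Q, ∀ x : P, (e x : G) = f x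

theorem exists_mapsOnto {P Q : Subgroup G} {e : P ≃* Q} (he : e ∈ F.Iso P Q) :
    ∃ f, F.MapsOnto f P Q ∧ ∀ x : P, (e x : G) = f x := by
  classical
  have h : ∀ x : P, (e x : G) = (fun y => if h : y ∈ P then (e ⟨y, h⟩ : G) else 1) x := by
    rintro ⟨x, hx⟩
    simp [hx]
  exact ⟨fun y => if h : y ∈ P then (e ⟨y, h⟩ : G) else 1, ⟨e, he, h⟩, h⟩

theorem exists_mapsOnto_of_hom {P Q : Subgroup G} {φ : P →* Q} (hφ : φ ∈ F.Hom P Q) :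
    ∃ f R, R ≤ Q ∧ F.MapsOnto f P R ∧ ∀ x : P, (φ x : G) = f x := by
  obtain ⟨R, hR, e, he, he', rfl⟩ := F.exists_iso hφ
  obtain ⟨f, hf, hf'⟩ := exists_mapsOnto (F := F) (e := e) ⟨he, he'⟩
  exact ⟨f, R, hR, hf, hf'⟩

theorem inclusion_mem_hom {P Q : Subgroup G} (h : P ≤ Q) (hQ : Q ≤ S) :
    inclusion h ∈ F.Hom P Q :=
  F.conj_mem (h.trans hQ) hQ 1 S.one_mem _ (by simp)

namespace MapsOnto

variable {f g : G → G} {P Q R P' Q' : Subgroup G} {x y : G}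

theorem source_le (h : F.MapsOnto f P Q) : P ≤ S := by
  obtain ⟨e, he, -⟩ := h
  exact F.source_le he.1

theorem target_le (h : F.MapsOnto f P Q) : Q ≤ S := by
  obtain ⟨e, he, -⟩ := h
  exact F.target_le he.1

theorem isConj (h : F.MapsOnto f P Q) : F.IsConj P Q := by
  obtain ⟨e, he, -⟩ := h
  exact ⟨e, he⟩

theorem mem (h : F.MapsOnto f P Q) (hx : x ∈ P) : f x ∈ Q := by
  obtain ⟨e, -, h⟩ := h
  exact h ⟨x, hx⟩ ▸ (e ⟨x, hx⟩).2

theorem map_mul (h : F.MapsOnto f P Q) (hx : x ∈ P) (hy : y ∈ P) : f (x * y) = f x * f y := by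
  obtain ⟨e, -, h⟩ := h
  rw [← h ⟨x, hx⟩, ← h ⟨y, hy⟩, ← h ⟨x * y, P.mul_mem hx hy⟩, ← Subgroup.coe_mul,
    ← _root_.map_mul]
  rfl

theorem map_inv (h : F.MapsOnto f P Q) (hx : x ∈ P) : f x⁻¹ = (f x)⁻¹ := by
  obtain ⟨e, -, h⟩ := h
  rw [← h ⟨x, hx⟩, ← h ⟨x⁻¹, P.inv_mem hx⟩, ← Subgroup.coe_inv, ← _root_.map_inv]
  rfl

theorem map_conj (h : F.MapsOnto f P Q) (hy : y ∈ P) (hx : x ∈ P) :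
    f (y * x * y⁻¹) = f y * f x * (f y)⁻¹ := by
  rw [h.map_mul (P.mul_mem hy hx) (P.inv_mem hy), h.map_mul hy hx, h.map_inv hy]

theorem inj (h : F.MapsOnto f P Q) (hx : x ∈ P) (hy : y ∈ P) (hxy : f x = f y) : x = y := by
  obtain ⟨e, -, h⟩ := h
  rw [← h ⟨x, hx⟩, ← h ⟨y, hy⟩] at hxy
  exact congrArg Subtype.val (e.injective (Subtype.ext hxy))

theorem surj (h : F.MapsOnto f P Q) (hy : y ∈ Q) : ∃ x ∈ P, f x = y := by
  obtain ⟨e, -, h⟩ := h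
  exact ⟨e.symm ⟨y, hy⟩, (e.symm ⟨y, hy⟩).2, by rw [← h]; simp⟩

theorem card_eq (h : F.MapsOnto f P Q) : Nat.card P = Nat.card Q := by
  obtain ⟨e, -, h⟩ := h
  exact Nat.card_congr e.toEquiv

theorem congr (h : F.MapsOnto f P Q) (hfg : ∀ x ∈ P, g x = f x) : F.MapsOnto g P Q := by
  obtain ⟨e, he, h⟩ := h
  exact ⟨e, he, fun x => by rw [h, hfg x x.2]⟩

theorem comp (h : F.MapsOnto f P Q) (h' : F.MapsOnto g Q R) : F.MapsOnto (g ∘ f) P R := by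
  obtain ⟨e, he, h⟩ := h
  obtain ⟨e', he', h'⟩ := h'
  refine ⟨e.trans e', ⟨F.comp_mem he.1 he'.1, F.comp_mem he'.2 he.2⟩, fun x => ?_⟩
  rw [Function.comp_apply, ← h, ← h']
  rfl

theorem symm (h : F.MapsOnto f P Q) : ∃ g, F.MapsOnto g Q P ∧ (∀ x ∈ P, g (f x) = x) ∧
    ∀ y ∈ Q, f (g y) = y := by
  obtain ⟨e, he, h⟩ := h
  obtain ⟨g, hg, hg'⟩ := exists_mapsOnto (F := F) (e := e.symm) ⟨he.2, he.1⟩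
  refine ⟨g, hg, fun x hx => ?_, fun y hy => ?_⟩
  · rw [← h ⟨x, hx⟩, ← hg', e.symm_apply_apply]
  · rw [← hg' ⟨y, hy⟩, ← h, e.apply_symm_apply]

theorem restrict (h : F.MapsOnto f P Q) (hP : P' ≤ P) : ∃ Q' ≤ Q, F.MapsOnto f P' Q' := by
  obtain ⟨e, he, h⟩ := h
  have h1 := F.comp_mem (inclusion_mem_hom hP (F.source_le he.1)) he.1
  obtain ⟨Q', hQ', e', he', he'', heq⟩ := F.exists_iso h1
  refine ⟨Q', hQ', e', ⟨he', he''⟩, fun x => ?_⟩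
  have h2 := congrArg (fun φ => ((φ x : Q) : G)) heq
  change (e (inclusion hP x) : G) = (e' x : G) at h2
  rw [← h2, h]
  rfl

theorem target_le_of_forall (h : F.MapsOnto f P Q) (h' : ∀ x ∈ P, f x ∈ R) : Q ≤ R := by
  intro y hy
  obtain ⟨x, hx, rfl⟩ := h.surj hy
  exact h' x hx

theorem target_unique (h : F.MapsOnto f P Q) (h' : F.MapsOnto f P Q') : Q = Q' :=
  le_antisymm (h.target_le_of_forall fun _ hx => h'.mem hx)
    (h'.target_le_of_forall fun _ hx => h.mem hx)

/-- Restriction of a morphism to a subgroup whose image is known. -/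
theorem restrict_of_mem_iff (h : F.MapsOnto f P Q) (hP : P' ≤ P) (hQ : Q' ≤ Q)
    (h' : ∀ x ∈ P, x ∈ P' ↔ f x ∈ Q') : F.MapsOnto f P' Q' := by
  obtain ⟨R, hR, hf⟩ := h.restrict hP
  have : R = Q' := by
    refine le_antisymm (hf.target_le_of_forall fun x hx => (h' x (hP hx)).1 hx) fun y hy => ?_
    obtain ⟨x, hx, rfl⟩ := h.surj (hQ hy)
    exact hf.mem ((h' x hx).2 hy)
  exact this ▸ hf

theorem mem_iff (h : F.MapsOnto f P Q) (h' : F.MapsOnto f P' Q') (hP : P' ≤ P) (hx : x ∈ P) :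
    f x ∈ Q' ↔ x ∈ P' := by
  refine ⟨fun hx' => ?_, h'.mem⟩
  obtain ⟨y, hy, hyx⟩ := h'.surj hx'
  exact h.inj (hP hy) hx hyx ▸ hy

theorem mem_normalizer (h : F.MapsOnto f P Q) (h' : F.MapsOnto f P' Q') (hP : P' ≤ P)
    (hx : x ∈ P) (hn : x ∈ normalizer (P' : Set G)) : f x ∈ normalizer (Q' : Set G) := by
  have hQ : Q' ≤ Q := h'.target_le_of_forall fun y hy => h.mem (hP hy)
  refine mem_normalizer_iff.2 fun z => ⟨fun hz => ?_, fun hz => ?_⟩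
  · obtain ⟨y, hy, rfl⟩ := h'.surj hz
    rw [← h.map_conj hx (hP hy)]
    exact h'.mem ((mem_normalizer_iff.1 hn y).1 hy)
  · obtain ⟨y, hy, hyz⟩ := h'.surj hz
    have hy' := (mem_normalizer_iff''.1 hn y).1 hy
    have h2 := h.map_conj hx (hP hy')
    rw [show x * (x⁻¹ * y * x) * x⁻¹ = y by group, hyz, mul_left_inj, mul_right_inj] at h2
    rw [h2]
    exact h'.mem hy'

end MapsOnto

theorem mapsOnto_id {P : Subgroup G} (hP : P ≤ S) : F.MapsOnto id P P :=
  ⟨MulEquiv.refl P, ⟨F.id_mem hP, F.id_mem hP⟩, fun _ => rfl⟩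

theorem mapsOnto_conj {P : Subgroup G} (hP : P ≤ S) {g : G} (hg : g ∈ S)
    (hgP : g ∈ normalizer (P : Set G)) : F.MapsOnto (fun x => g * x * g⁻¹) P P := by
  refine ⟨P.normalizerMonoidHom ⟨g, hgP⟩, ⟨F.conj_mem hP hP g hg _ fun x => rfl,
    F.conj_mem hP hP g⁻¹ (S.inv_mem hg) _ fun x => ?_⟩, fun x => rfl⟩
  have : ((P.normalizerMonoidHom ⟨g, hgP⟩).symm x : G) = g⁻¹ * x * g⁻¹⁻¹ := by
    obtain ⟨y, rfl⟩ := (P.normalizerMonoidHom ⟨g, hgP⟩).surjective x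
    rw [MulEquiv.symm_apply_apply]
    change (y : G) = g⁻¹ * (g * y * g⁻¹) * g⁻¹⁻¹
    group
  exact this

theorem mem_hom_of_mapsOnto {f : G → G} {P Q P' Q' : Subgroup G} (h : F.MapsOnto f P Q)
    (hP : P' ≤ P) (hQ : Q ≤ Q') (hQ' : Q' ≤ S) :
    ∃ φ ∈ F.Hom P' Q', ∀ x : P', (φ x : G) = f x := by
  obtain ⟨e, he, h⟩ := h
  refine ⟨_, F.comp_mem (inclusion_mem_hom hP (F.source_le he.1))
    (F.comp_mem he.1 (inclusion_mem_hom hQ hQ')), fun x => ?_⟩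
  exact h (inclusion hP x)

theorem mem_aut_of_mapsOnto {P : Subgroup G} {hP : P ≤ S} {a : MulAut P} {f : G → G}
    (h : F.MapsOnto f P P) (ha : ∀ x : P, (a x : G) = f x) : a ∈ F.aut P hP := by
  obtain ⟨e, he, h⟩ := h
  have : a = e := MulEquiv.ext fun x => Subtype.ext ((ha x).trans (h x).symm)
  exact this ▸ he

theorem MapsOnto.exists_aut {f : G → G} {P : Subgroup G} (h : F.MapsOnto f P P) (hP : P ≤ S) :
    ∃ a ∈ F.aut P hP, ∀ x : P, (a x : G) = f x := by
  obtain ⟨e, he, h⟩ := h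
  exact ⟨e, he, h⟩

theorem mem_autS_iff {P : Subgroup G} {a : MulAut P} : a ∈ autS S P ↔
    ∃ s ∈ S ⊓ normalizer (P : Set G), ∀ x : P, (a x : G) = s * x * s⁻¹ := by
  constructor
  · rintro ⟨s, hs, rfl⟩
    exact ⟨s, ⟨mem_subgroupOf.1 hs, s.2⟩, fun x => rfl⟩
  · rintro ⟨s, hs, h⟩
    refine ⟨⟨s, hs.2⟩, mem_subgroupOf.2 hs.1, ?_⟩
    exact MulEquiv.ext fun x => Subtype.ext (h x).symm

theorem autS_le_aut {P : Subgroup G} (hP : P ≤ S) : autS S P ≤ F.aut P hP := by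
  intro a ha
  obtain ⟨s, hs, h⟩ := mem_autS_iff.1 ha
  exact mem_aut_of_mapsOnto (mapsOnto_conj hP hs.1 hs.2) h

theorem isPGroup_autS {p : ℕ} (hS : IsPGroup p S) (P : Subgroup G) : IsPGroup p (autS S P) := by
  refine IsPGroup.map ?_ _
  rintro ⟨g, hg⟩
  obtain ⟨k, hk⟩ := hS ⟨g, mem_subgroupOf.1 hg⟩
  refine ⟨k, Subtype.ext (Subtype.ext ?_)⟩
  simpa using congrArg Subtype.val hk

theorem mem_extender_iff {P Q : Subgroup G} {e : Q ≃* P} {f : G → G}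
    (h : ∀ x : Q, (e x : G) = f x) {n : G} : n ∈ extender S e ↔
      n ∈ S ⊓ normalizer (Q : Set G) ∧ ∃ s ∈ S ⊓ normalizer (P : Set G),
        ∀ x ∈ Q, f (n * x * n⁻¹) = s * f x * s⁻¹ := by
  have key : ∀ (hn : n ∈ normalizer (Q : Set G)),
      MulAut.congr e (Q.normalizerMonoidHom ⟨n, hn⟩) ∈ autS S P ↔
        ∃ s ∈ S ⊓ normalizer (P : Set G), ∀ x ∈ Q, f (n * x * n⁻¹) = s * f x * s⁻¹ := by
    intro hn
    rw [mem_autS_iff]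
    refine exists_congr fun s => and_congr_right fun _ => ⟨fun H x hx => ?_, fun H y => ?_⟩
    · have := H (e ⟨x, hx⟩)
      change (e (Q.normalizerMonoidHom ⟨n, hn⟩ (e.symm (e ⟨x, hx⟩))) : G) = _ at this
      rw [e.symm_apply_apply, h, h] at this
      exact this
    · change (e (Q.normalizerMonoidHom ⟨n, hn⟩ (e.symm y)) : G) = _
      rw [h]
      have := H _ (e.symm y).2
      rw [← h (e.symm y), e.apply_symm_apply] at this
      exact this
  constructor
  · rintro ⟨hS, m, hm, rfl⟩
    exact ⟨⟨hS, m.2⟩, (key m.2).1 hm⟩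
  · rintro ⟨hn, H⟩
    exact ⟨hn.1, ⟨n, hn.2⟩, (key hn.2).2 H, rfl⟩

/-- The extension property of receptive subgroups. -/
theorem Receptive.exists_extension {R R' : Subgroup G} (hR : F.Receptive R) {h : G → G}
    (hh : F.MapsOnto h R' R) : ∃ f N B, F.MapsOnto f N B ∧ R' ≤ N ∧ (∀ x ∈ R', f x = h x) ∧
      ∀ n ∈ S ⊓ normalizer (R' : Set G), ∀ s ∈ S ⊓ normalizer (R : Set G),
        (∀ x ∈ R', h (n * x * n⁻¹) = s * h x * s⁻¹) → n ∈ N := by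
  obtain ⟨e, he, heh⟩ := hh
  have hh : F.MapsOnto h R' R := ⟨e, he, heh⟩
  obtain ⟨ψ, hψ, -, hle, hψ'⟩ := hR.2 R' e he
  obtain ⟨f, B, -, hf, hf'⟩ := exists_mapsOnto_of_hom hψ
  refine ⟨f, _, B, hf, hle, fun x hx => ?_, fun n hn s hs H => (mem_extender_iff heh).2
    ⟨hn, s, hs, H⟩⟩
  rw [← heh ⟨x, hx⟩]
  exact (hf' (inclusion hle ⟨x, hx⟩)).symm.trans (hψ' ⟨x, hx⟩)

/-- Converse of `Receptive.exists_extension`. The domain `N` may exceed the extender, since the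
extension can be restricted. -/
theorem receptive_of_forall {P : Subgroup G} (hP : P ≤ S)
    (H : ∀ (Q : Subgroup G) (h : G → G), F.MapsOnto h Q P → ∃ f N B, F.MapsOnto f N B ∧ Q ≤ N ∧
      (∀ x ∈ Q, f x = h x) ∧
      ∀ n ∈ S ⊓ normalizer (Q : Set G), ∀ s ∈ S ⊓ normalizer (P : Set G),
        (∀ x ∈ Q, h (n * x * n⁻¹) = s * h x * s⁻¹) → n ∈ N) : F.Receptive P := by
  refine ⟨hP, fun Q e he => ?_⟩
  obtain ⟨h, hh, heh⟩ := exists_mapsOnto he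
  obtain ⟨f, N, B, hf, hQN, hfh, hN⟩ := H Q h hh
  have hle : extender S e ≤ N := by
    intro n hn
    obtain ⟨hn, s, hs, H⟩ := (mem_extender_iff heh).1 hn
    exact hN n hn s hs H
  obtain ⟨φ, hφ, hφ'⟩ := mem_hom_of_mapsOnto hf hle hf.target_le le_rfl
  have hQ : Q ≤ extender S e := by
    intro x hx
    have hx' := hh.mem hx
    exact (mem_extender_iff heh).2 ⟨⟨hh.source_le hx, le_normalizer hx⟩, h x,
      ⟨hP hx', le_normalizer hx'⟩, fun y hy => hh.map_conj hx hy⟩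
  refine ⟨φ, hφ, hP, hQ, fun x => ?_⟩
  rw [hφ']
  exact (hfh x x.2).trans (heh x).symm

end FusionSystem

/-! ### Restricting automorphisms to an invariant subgroup; well placed pairs -/

theorem IsSylowIn.map {M : Type*} [Group M] {p : ℕ} {W H : Subgroup M} (h : IsSylowIn p W H)
    (φ : M ≃* M) : IsSylowIn p (W.map φ.toMonoidHom) (H.map φ.toMonoidHom) := by
  refine ⟨map_mono h.1, h.2.1.map _, ?_⟩
  rw [relIndex_map_map_of_injective _ _ φ.injective]
  exact h.2.2

namespace FusionSystem

variable {G : Type*} [Group G] {S : Subgroup G} {F : FusionSystem S} {p : ℕ}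

theorem finite_mulAut [Finite S] {R : Subgroup G} (hR : R ≤ S) : Finite (MulAut R) := by
  have : Finite R := Finite.of_injective _ (inclusion_injective hR)
  exact Finite.of_injective (fun a : MulAut R => (a : R → R)) DFunLike.coe_injective

/-- The automorphisms of `R` in `F` that leave `Z` invariant. -/
def autStab (F : FusionSystem S) (R Z : Subgroup G) (hR : R ≤ S) : Subgroup (MulAut R) where
  carrier := {a | a ∈ F.aut R hR ∧ ∀ x : R, (x : G) ∈ Z ↔ (a x : G) ∈ Z}
  one_mem' := ⟨one_mem _, fun _ => Iff.rfl⟩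
  mul_mem' := fun ha hb => ⟨mul_mem ha.1 hb.1, fun x => (hb.2 x).trans (ha.2 _)⟩
  inv_mem' := by
    rintro a ⟨ha, ha'⟩
    refine ⟨inv_mem ha, fun x => ?_⟩
    have := ha' (a⁻¹ x)
    rw [MulAut.apply_inv_self] at this
    exact this.symm

theorem exists_mapsOnto_of_mem_autStab {R Z : Subgroup G} {hR : R ≤ S} (hZ : Z ≤ R) {a : MulAut R}
    (ha : a ∈ F.autStab R Z hR) :
    ∃ f, F.MapsOnto f R R ∧ F.MapsOnto f Z Z ∧ ∀ x : R, (a x : G) = f x := by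
  obtain ⟨f, hf, hfa⟩ := exists_mapsOnto ha.1
  refine ⟨f, hf, hf.restrict_of_mem_iff hZ hZ fun x hx => ?_, hfa⟩
  rw [← hfa ⟨x, hx⟩]
  exact ha.2 ⟨x, hx⟩

theorem MapsOnto.exists_autStab {f : G → G} {R Z : Subgroup G} (h : F.MapsOnto f R R)
    (h' : F.MapsOnto f Z Z) (hZ : Z ≤ R) (hR : R ≤ S) :
    ∃ a ∈ F.autStab R Z hR, ∀ x : R, (a x : G) = f x := by
  obtain ⟨a, ha, hf⟩ := h.exists_aut hR
  refine ⟨a, ⟨ha, fun x => ?_⟩, hf⟩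
  rw [hf]
  exact (h.mem_iff h' hZ x.2).symm

/-- Restriction of automorphisms of `R` to an invariant subgroup `Z`. -/
def resHom (F : FusionSystem S) {R Z : Subgroup G} (hR : R ≤ S) (hZ : Z ≤ R) :
    F.autStab R Z hR →* MulAut Z where
  toFun a :=
    { toFun := fun z => ⟨(a : MulAut R) (inclusion hZ z), (a.2.2 _).1 z.2⟩
      invFun := fun z => ⟨(a : MulAut R)⁻¹ (inclusion hZ z), ((a⁻¹).2.2 _).1 z.2⟩
      left_inv := fun z => Subtype.ext (by
        have : (a : MulAut R)⁻¹ ((a : MulAut R) (inclusion hZ z)) = inclusion hZ z :=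
          MulAut.inv_apply_self _ _ _
        exact congrArg (fun y : R => (y : G)) this)
      right_inv := fun z => Subtype.ext (by
        have : (a : MulAut R) ((a : MulAut R)⁻¹ (inclusion hZ z)) = inclusion hZ z :=
          MulAut.apply_inv_self _ _ _
        exact congrArg (fun y : R => (y : G)) this)
      map_mul' := fun x y => Subtype.ext (by
        change (((a : MulAut R) (inclusion hZ (x * y)) : R) : G) = _
        rw [map_mul, map_mul]
        rfl) }
  map_one' := rfl
  map_mul' _ _ := rfl

theorem coe_resHom_apply {R Z : Subgroup G} {hR : R ≤ S} {hZ : Z ≤ R} (a : F.autStab R Z hR)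
    (z : Z) : (F.resHom hR hZ a z : G) = (a : MulAut R) (inclusion hZ z) :=
  rfl

theorem resHom_mem_aut {R Z : Subgroup G} {hR : R ≤ S} {hZ : Z ≤ R} (a : F.autStab R Z hR) :
    F.resHom hR hZ a ∈ F.aut Z (hZ.trans hR) := by
  obtain ⟨f, -, hf, hfa⟩ := exists_mapsOnto_of_mem_autStab hZ a.2
  exact mem_aut_of_mapsOnto hf fun z => hfa (inclusion hZ z)

/-- The automorphisms of `R` in `F` that leave `Z` invariant and act on `Z` as a member of `C`. -/
def autRes (F : FusionSystem S) {R Z : Subgroup G} (hR : R ≤ S) (hZ : Z ≤ R)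
    (C : Subgroup (MulAut Z)) : Subgroup (MulAut R) :=
  (C.comap (F.resHom hR hZ)).map (F.autStab R Z hR).subtype

theorem mem_autRes_iff {R Z : Subgroup G} {hR : R ≤ S} {hZ : Z ≤ R} {C : Subgroup (MulAut Z)}
    {a : MulAut R} : a ∈ F.autRes hR hZ C ↔
      ∃ ha : a ∈ F.autStab R Z hR, F.resHom hR hZ ⟨a, ha⟩ ∈ C := by
  constructor
  · rintro ⟨b, hb, rfl⟩
    exact ⟨b.2, hb⟩
  · rintro ⟨ha, h⟩
    exact ⟨⟨a, ha⟩, h, rfl⟩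

theorem autRes_le {R Z : Subgroup G} {hR : R ≤ S} {hZ : Z ≤ R} {C : Subgroup (MulAut Z)} :
    F.autRes hR hZ C ≤ F.autStab R Z hR :=
  map_subtype_le _

theorem conj_mem_autRes {R Z : Subgroup G} {hR : R ≤ S} {hZ : Z ≤ R} {C : Subgroup (MulAut Z)}
    (hC : ∀ g ∈ F.aut Z (hZ.trans hR), ∀ c ∈ C, g * c * g⁻¹ ∈ C) :
    ∀ g ∈ F.autStab R Z hR, ∀ n ∈ F.autRes hR hZ C, g * n * g⁻¹ ∈ F.autRes hR hZ C := by
  intro g hg n hn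
  obtain ⟨hn, hn'⟩ := mem_autRes_iff.1 hn
  refine mem_autRes_iff.2 ⟨mul_mem (mul_mem hg hn) (inv_mem hg), ?_⟩
  have h := hC _ (resHom_mem_aut (hZ := hZ) ⟨g, hg⟩) _ hn'
  rwa [← map_inv, ← map_mul, ← map_mul] at h

theorem mem_autRes_bot_iff {R Z : Subgroup G} {hR : R ≤ S} {hZ : Z ≤ R} {a : MulAut R}
    (ha : a ∈ F.autStab R Z hR) :
    a ∈ F.autRes hR hZ ⊥ ↔ ∀ z ∈ Z, ∀ hz : z ∈ R, (a ⟨z, hz⟩ : G) = z := by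
  rw [mem_autRes_iff]
  constructor
  · rintro ⟨ha, h⟩ z hz hz'
    have h1 := coe_resHom_apply (hZ := hZ) ⟨a, ha⟩ ⟨z, hz⟩
    rw [mem_bot.1 h] at h1
    exact h1.symm
  · intro H
    exact ⟨ha, mem_bot.2 (MulEquiv.ext fun z => Subtype.ext (H z z.2 (hZ z.2)))⟩

/-- `R` is receptive, and the automorphisms of `R` induced by `S` that leave `Z` invariant form a
Sylow `p`-subgroup of the group of all automorphisms of `R` in `F` that leave `Z` invariant. -/
def WellPlaced (F : FusionSystem S) (p : ℕ) (R Z : Subgroup G) : Prop :=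
  Z ≤ R ∧ F.Receptive R ∧
    ∃ hR : R ≤ S, IsSylowIn p (autS S R ⊓ F.autStab R Z hR) (F.autStab R Z hR)

/-- A Sylow subgroup of the stabilizer of `X` can be conjugated into `Aut_S(R)` because `R` is fully
automized; the conjugating automorphism carries `X` to the required `Z`. -/
theorem exists_wellPlaced [Fact p.Prime] [Finite S] (hS : IsPGroup p S) {R X : Subgroup G}
    (hR : F.FullyAutomized p R) (hR' : F.Receptive R) (hX : X ≤ R) :
    ∃ f Z, F.MapsOnto f R R ∧ F.MapsOnto f X Z ∧ F.WellPlaced p R Z := by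
  obtain ⟨hRS, A, hA⟩ := hR
  have := finite_mulAut (S := S) hRS
  have hsyl : IsSylowIn p (autS S R) (F.aut R hRS) := hA ▸ A.isSylowIn
  obtain ⟨V, hV⟩ := exists_isSylowIn (p := p) (H := F.autStab R X hRS)
  obtain ⟨b, hb, hbV⟩ := hsyl.exists_conj_mem (B := V) (fun v hv => (hV.1 hv).1) hV.2.1
  obtain ⟨f, hf, hfb⟩ := exists_mapsOnto (F := F) (e := b) hb
  obtain ⟨Z, hZ, hfZ⟩ := hf.restrict hX
  refine ⟨f, Z, hf, hfZ, hZ, hR', hRS, ?_⟩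
  have hmem : ∀ x : R, (x : G) ∈ X ↔ (b x : G) ∈ Z := fun x => by
    rw [hfb]
    exact (hf.mem_iff hfZ hX x.2).symm
  have hmap : (F.autStab R X hRS).map (MulAut.conj b).toMonoidHom = F.autStab R Z hRS := by
    have hmem' : ∀ x : R, (x : G) ∈ Z ↔ ((b⁻¹ x : R) : G) ∈ X := fun x => by
      rw [hmem, MulAut.apply_inv_self]
    ext a
    constructor
    · rintro ⟨a, ha, rfl⟩
      refine ⟨mul_mem (mul_mem hb ha.1) (inv_mem hb), fun x => ?_⟩
      exact (hmem' x).trans ((ha.2 _).trans (hmem _))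
    · intro ha
      refine ⟨b⁻¹ * a * b, ⟨mul_mem (mul_mem (inv_mem hb) ha.1) hb, fun x => ?_⟩, ?_⟩
      · exact (hmem x).trans ((ha.2 _).trans (hmem' _))
      · simp [mul_assoc]
  have h1 := hV.map (MulAut.conj b)
  rw [hmap] at h1
  -- The conjugated Sylow subgroup lies in `Aut_S(R) ∩ Stab(Z)`, itself a `p`-group, so the two
  -- coincide.
  have h2 := h1.eq_of_le (V := autS S R ⊓ F.autStab R Z hRS)
    (le_inf (by rintro _ ⟨v, hv, rfl⟩; exact hbV v hv) h1.1) inf_le_right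
    ((isPGroup_autS hS R).to_le inf_le_left)
  rwa [h2]

/-- The group of automorphisms of `R` obtained from conjugation by elements of `N` along an
isomorphism `R' → R`. -/
theorem MapsOnto.exists_conj_subgroup {R R' X Z N : Subgroup G} {f : G → G} (hS : IsPGroup p S)
    (hf : F.MapsOnto f R' R) (hfX : F.MapsOnto f X Z) (hX : X ≤ R')
    (hN : N ≤ S ⊓ normalizer (R' : Set G)) (hNX : N ≤ normalizer (X : Set G)) (hR : R ≤ S) :
    ∃ B ≤ F.autStab R Z hR, IsPGroup p B ∧
      (∀ n ∈ N, ∃ b ∈ B, ∀ x (hx : x ∈ R'), (b ⟨f x, hf.mem hx⟩ : G) = f (n * x * n⁻¹)) ∧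
      ∀ b ∈ B, ∃ n ∈ N, ∀ x (hx : x ∈ R'), (b ⟨f x, hf.mem hx⟩ : G) = f (n * x * n⁻¹) := by
  obtain ⟨e, he, hef⟩ := hf
  have hf : F.MapsOnto f R' R := ⟨e, he, hef⟩
  let φ : N →* MulAut R := (MulAut.congr e).toMonoidHom.comp
    (R'.normalizerMonoidHom.comp (inclusion (hN.trans inf_le_right)))
  have hφ : ∀ (n : N) x (hx : x ∈ R'), (φ n ⟨f x, hf.mem hx⟩ : G) = f (n * x * n⁻¹) := by
    intro n x hx
    have h1 : (⟨f x, hf.mem hx⟩ : R) = e ⟨x, hx⟩ := Subtype.ext (hef ⟨x, hx⟩).symm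
    rw [h1]
    change (e (R'.normalizerMonoidHom _ (e.symm (e ⟨x, hx⟩))) : G) = _
    rw [e.symm_apply_apply, hef]
    rfl
  refine ⟨φ.range, ?_, ?_, fun n hn => ⟨_, ⟨⟨n, hn⟩, rfl⟩, hφ ⟨n, hn⟩⟩, ?_⟩
  · rintro _ ⟨n, rfl⟩
    obtain ⟨g, hg, hgf, hfg⟩ := hf.symm
    have hc := (hg.comp (mapsOnto_conj hf.source_le (hN n.2).1 (hN n.2).2)).comp hf
    have hval : ∀ y : R, (φ n y : G) = (f ∘ (fun x => n * x * (n : G)⁻¹) ∘ g) y := by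
      intro y
      have := hφ n (g y) (hg.mem y.2)
      have h2 : (⟨f (g y), hf.mem (hg.mem y.2)⟩ : R) = y := Subtype.ext (hfg y y.2)
      rw [h2] at this
      exact this
    refine ⟨mem_aut_of_mapsOnto hc hval, fun y => ?_⟩
    have h3 := mem_normalizer_iff.1 (hNX n.2) (g y)
    rw [hval y]
    conv_lhs => rw [← hfg y y.2]
    rw [hf.mem_iff hfX hX (hg.mem y.2), h3]
    exact (hf.mem_iff hfX hX
      ((mem_normalizer_iff.1 (hN n.2).2 _).1 (hg.mem y.2))).symm
  · have hNp : IsPGroup p N := hS.to_le (hN.trans inf_le_left)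
    rw [MonoidHom.range_eq_map]
    exact (hNp.of_equiv (topEquiv (G := N)).symm).map φ
  · rintro _ ⟨n, rfl⟩
    exact ⟨n, n.2, hφ n⟩

/-- Conjugation along `f` turns `N_S(R') ∩ N_S(X)` into a `p`-group of automorphisms of `R`
stabilizing `Z`. Sylow's theorem moves it into `Aut_S(R)` after composing `f` with an element of the
stabilizer; receptivity then extends the corrected map. Its restriction to `X` may differ from that
of `f`. -/
theorem WellPlaced.exists_extension_normalizer [Fact p.Prime] [Finite S] (hS : IsPGroup p S)
    {R R' X Z : Subgroup G} (hw : F.WellPlaced p R Z) {f : G → G}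
    (hf : F.MapsOnto f R' R) (hfX : F.MapsOnto f X Z) (hX : X ≤ R') :
    ∃ h N B, F.MapsOnto h N B ∧ F.MapsOnto h R' R ∧ F.MapsOnto h X Z ∧
      S ⊓ normalizer (R' : Set G) ⊓ normalizer (X : Set G) ≤ N ∧ R' ≤ N := by
  obtain ⟨hZ, hrec, hRS, hsyl⟩ := hw
  have := finite_mulAut (S := S) hRS
  obtain ⟨B, hB, hBp, hNB, -⟩ := hf.exists_conj_subgroup hS hfX hX
    (N := S ⊓ normalizer (R' : Set G) ⊓ normalizer (X : Set G)) inf_le_left inf_le_right hRS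
  obtain ⟨a, ha, haB⟩ := hsyl.exists_conj_mem hB hBp
  obtain ⟨k, hkR, hkZ, hka⟩ := exists_mapsOnto_of_mem_autStab hZ ha
  have hh := hf.comp hkR
  obtain ⟨h, N, C, hh1, hR'N, hh2, hN⟩ := hrec.exists_extension hh
  refine ⟨h, N, C, hh1, hh.congr hh2, (hfX.comp hkZ).congr fun x hx => hh2 x (hX hx), ?_, hR'N⟩
  intro n hn
  obtain ⟨b, hb, hbn⟩ := hNB n hn
  obtain ⟨s, hs, hsa⟩ := mem_autS_iff.1 (haB b hb).1
  refine hN n hn.1 s hs fun x hx => ?_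
  have h1 := hsa (a ⟨f x, hf.mem hx⟩)
  change (a (b (a⁻¹ (a ⟨f x, hf.mem hx⟩))) : G) = _ at h1
  rw [MulAut.inv_apply_self, hka, hka, hbn x hx] at h1
  exact h1

/-- The automorphism of `R` induced by `s`, as an automorphism leaving `Z` invariant. -/
theorem exists_mem_autS_inf_autStab {R Z : Subgroup G} (hR : R ≤ S) {s : G}
    (hs : s ∈ S ⊓ normalizer (R : Set G) ⊓ normalizer (Z : Set G)) :
    ∃ w ∈ autS S R ⊓ F.autStab R Z hR, ∀ x : R, (w x : G) = s * x * s⁻¹ := by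
  have h : R.normalizerMonoidHom ⟨s, hs.1.2⟩ ∈ autS S R :=
    mem_autS_iff.2 ⟨s, hs.1, fun x => rfl⟩
  exact ⟨_, ⟨h, autS_le_aut hR h, fun x => mem_normalizer_iff.1 hs.2 x⟩, fun x => rfl⟩

/-- Here the values of `f` on `X` are kept. This is possible because, by `hc`, the automorphisms of
`R` coming from `N₀` agree on `Z` with elements of the Sylow subgroup `Aut_S(R) ∩ Stab(Z)`, so the
correcting automorphism can be chosen trivial on `Z`. -/
theorem WellPlaced.exists_extension [Fact p.Prime] [Finite S] (hS : IsPGroup p S)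
    {R R' X Z N₀ : Subgroup G} (hw : F.WellPlaced p R Z) {f : G → G}
    (hf : F.MapsOnto f R' R) (hfX : F.MapsOnto f X Z) (hX : X ≤ R')
    (hN₀ : N₀ ≤ S ⊓ normalizer (R' : Set G) ⊓ normalizer (X : Set G))
    (hc : ∀ n ∈ N₀, ∃ s ∈ S ⊓ normalizer (R : Set G) ⊓ normalizer (Z : Set G),
      ∀ x ∈ X, f (n * x * n⁻¹) = s * f x * s⁻¹) :
    ∃ h N B, F.MapsOnto h N B ∧ F.MapsOnto h R' R ∧ (∀ x ∈ X, h x = f x) ∧ N₀ ≤ N ∧ R' ≤ N := by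
  obtain ⟨hZ, hrec, hRS, hsyl⟩ := hw
  have := finite_mulAut (S := S) hRS
  obtain ⟨B, hB, hBp, hNB, hBN⟩ := hf.exists_conj_subgroup hS hfX hX
    (hN₀.trans inf_le_left) (hN₀.trans inf_le_right) hRS
  have hKH : F.autRes hRS hZ ⊥ ≤ F.autStab R Z hRS := autRes_le
  obtain ⟨a, ha, haB⟩ := hsyl.exists_conj_mem_of_mem_sup (B := B) hKH
    (conj_mem_autRes fun g _ c hc => by simp [mem_bot.1 hc]) hBp (by
    intro b hb
    obtain ⟨n, hn, hbn⟩ := hBN b hb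
    obtain ⟨s, hs, hsn⟩ := hc n hn
    obtain ⟨w, hw, hws⟩ := exists_mem_autS_inf_autStab (F := F) hRS hs
    refine ⟨w, hw, w⁻¹ * b, (mem_autRes_bot_iff (mul_mem (inv_mem hw.2) (hB hb))).2 fun z hz hz' => ?_, by group⟩
    obtain ⟨x, hx, rfl⟩ := hfX.surj hz
    have h1 : b ⟨f x, hz'⟩ = w ⟨f x, hz'⟩ := Subtype.ext (by
      rw [hws, hbn x (hX hx), hsn x hx])
    change ((w⁻¹ (b ⟨f x, hz'⟩) : R) : G) = _
    rw [h1, MulAut.inv_apply_self])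
  obtain ⟨k, hkR, hkZ, hka⟩ := exists_mapsOnto_of_mem_autStab hZ (hKH ha)
  have hh := hf.comp hkR
  obtain ⟨h, N, C, hh1, hR'N, hh2, hN⟩ := hrec.exists_extension hh
  refine ⟨h, N, C, hh1, hh.congr hh2, fun x hx => ?_, fun n hn => ?_, hR'N⟩
  · have hz := hfX.mem hx
    rw [hh2 x (hX hx), Function.comp_apply, ← hka ⟨f x, hZ hz⟩]
    exact (mem_autRes_bot_iff (hKH ha)).1 ha _ hz _
  · obtain ⟨b, hb, hbn⟩ := hNB n hn
    obtain ⟨s, hs, hsa⟩ := mem_autS_iff.1 (haB b hb).1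
    refine hN n (hN₀ hn).1 s hs fun x hx => ?_
    have h1 := hsa (a ⟨f x, hf.mem hx⟩)
    change (a (b (a⁻¹ (a ⟨f x, hf.mem hx⟩))) : G) = _ at h1
    rw [MulAut.inv_apply_self, hka, hka, hbn x hx] at h1
    exact h1

/-- `f` acts on `P` as an element of the largest normal `p`-subgroup of `Aut_F(P)`. -/
def CoreAct (F : FusionSystem S) (p : ℕ) (P : Subgroup G) (f : G → G) : Prop :=
  ∃ hP : P ≤ S, ∃ b ∈ pCore p (F.aut P hP), ∀ x : P, (b x : G) = f x

/-- The preimage of `O_p(Aut_F(Z))` in the stabilizer of `Z` in `Aut_F(R)` is normal, and a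
`p`-group modulo the automorphisms trivial on `Z`. Hence each of its elements agrees on `Z` with an
element of the Sylow subgroup induced by `S`. -/
theorem WellPlaced.exists_conj_of_coreAct [Fact p.Prime] [Finite S]
    {R Z : Subgroup G} (hw : F.WellPlaced p R Z) {f : G → G}
    (hf : F.MapsOnto f R R) (hfZ : F.MapsOnto f Z Z) (h : F.CoreAct p Z f) :
    ∃ s ∈ S ⊓ normalizer (R : Set G) ⊓ normalizer (Z : Set G), ∀ x ∈ Z, f x = s * x * s⁻¹ := by
  obtain ⟨hZ, hrec, hRS, hsyl⟩ := hw
  have := finite_mulAut (S := S) hRS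
  obtain ⟨hZS, b, hb, hbf⟩ := h
  obtain ⟨a, ha, haf⟩ := hf.exists_autStab hfZ hZ hRS
  have hab : F.resHom hRS hZ ⟨a, ha⟩ = b :=
    MulEquiv.ext fun z => Subtype.ext ((haf _).trans (hbf z).symm)
  obtain ⟨w, hw, n, hn, hwn⟩ := hsyl.exists_eq_mul
    (conj_mem_autRes (C := ⊥) (hZ := hZ) fun g _ c hc => by simp [mem_bot.1 hc])
    (autRes_le (C := pCore p (F.aut Z hZS)))
    (conj_mem_autRes fun g hg c hc => conj_mem_pCore hg hc) (by
      intro n hn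
      obtain ⟨hn, hn'⟩ := mem_autRes_iff.1 hn
      obtain ⟨k, hk⟩ := isPGroup_pCore (p := p) _ ⟨_, hn'⟩
      refine ⟨k, mem_autRes_iff.2 ⟨pow_mem hn _, mem_bot.2 ?_⟩⟩
      have h1 : F.resHom hRS hZ ⟨n, hn⟩ ^ p ^ k = 1 := congrArg Subtype.val hk
      rwa [← map_pow] at h1)
    (mem_autRes_iff.2 ⟨ha, hab.symm ▸ hb⟩)
  obtain ⟨s, hs, hsw⟩ := mem_autS_iff.1 hw.1
  have hfs : ∀ x ∈ Z, f x = s * x * s⁻¹ := by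
    intro x hx
    rw [← haf ⟨x, hZ hx⟩, ← hsw ⟨x, hZ hx⟩, hwn]
    have : n ⟨x, hZ hx⟩ = ⟨x, hZ hx⟩ := Subtype.ext
      ((mem_autRes_bot_iff (autRes_le hn)).1 hn x hx _)
    exact congrArg (fun y : R => ((w y : R) : G)) this
  have : Finite Z := Finite.of_injective _ (inclusion_injective hZS)
  refine ⟨s, ⟨hs, mem_normalizer_of_conj_mem fun x hx => ?_⟩, hfs⟩
  rw [← hfs x hx]
  exact hfZ.mem hx

end FusionSystem

/-! ### Arrows within a conjugacy class, and their confluence -/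

theorem card_lt_card_of_lt {G : Type*} [Group G] {S P Q : Subgroup G} [Finite S] (h : P < Q)
    (hQ : Q ≤ S) : Nat.card P < Nat.card Q := by
  have : Finite Q := Finite.of_injective _ (inclusion_injective hQ)
  refine lt_of_le_of_ne (card_le_of_le h.le) fun hc => h.ne ?_
  exact eq_of_le_of_card_ge h.le hc.ge

theorem card_le_card_of_le {G : Type*} [Group G] {S P Q : Subgroup G} [Finite S] (h : P ≤ Q)
    (hQ : Q ≤ S) : Nat.card P ≤ Nat.card Q := by
  have : Finite Q := Finite.of_injective _ (inclusion_injective hQ)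
  exact card_le_of_le h

theorem eq_of_le_of_card_le {G : Type*} [Group G] {S P Q : Subgroup G} [Finite S] (h : P ≤ Q)
    (hQ : Q ≤ S) (hc : Nat.card Q ≤ Nat.card P) : P = Q := by
  have : Finite Q := Finite.of_injective _ (inclusion_injective hQ)
  exact eq_of_le_of_card_ge h hc

namespace FusionSystem

variable {G : Type*} [Group G] {S : Subgroup G} {F : FusionSystem S} {p : ℕ}

theorem IsConj.exists_mapsOnto {P Q : Subgroup G} (h : F.IsConj P Q) :
    ∃ f, F.MapsOnto f P Q := by
  obtain ⟨e, he⟩ := h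
  obtain ⟨f, hf, -⟩ := FusionSystem.exists_mapsOnto he
  exact ⟨f, hf⟩

theorem IsConj.symm {P Q : Subgroup G} (h : F.IsConj P Q) : F.IsConj Q P := by
  obtain ⟨e, he⟩ := h
  exact ⟨e.symm, he.2, he.1⟩

theorem IsConj.trans {P Q R : Subgroup G} (h : F.IsConj P Q) (h' : F.IsConj Q R) :
    F.IsConj P R := by
  obtain ⟨e, he⟩ := h
  obtain ⟨e', he'⟩ := h'
  exact ⟨e.trans e', F.comp_mem he.1 he'.1, F.comp_mem he'.2 he.2⟩

/-- The conjugacy class of `P` contains a fully automized and receptive subgroup. -/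
def IsSaturatedAt (F : FusionSystem S) (p : ℕ) (P : Subgroup G) : Prop :=
  ∃ Q, F.IsConj P Q ∧ F.FullyAutomized p Q ∧ F.Receptive Q

theorem IsSaturatedAt.of_isConj {P Q : Subgroup G} (h : F.IsSaturatedAt p P)
    (hPQ : F.IsConj P Q) : F.IsSaturatedAt p Q := by
  obtain ⟨R, hR, h⟩ := h
  exact ⟨R, hPQ.symm.trans hR, h⟩

theorem IsSaturatedAt.exists_wellPlaced [Fact p.Prime] [Finite S] (hS : IsPGroup p S)
    {R X : Subgroup G} (h : F.IsSaturatedAt p R) (hX : X ≤ R) :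
    ∃ f R' Z, F.MapsOnto f R R' ∧ F.MapsOnto f X Z ∧ F.WellPlaced p R' Z := by
  obtain ⟨R', hRR', hfa, hrec⟩ := h
  obtain ⟨f, hf⟩ := hRR'.exists_mapsOnto
  obtain ⟨Y, hY, hfY⟩ := hf.restrict hX
  obtain ⟨g, Z, hg, hgZ, hw⟩ := FusionSystem.exists_wellPlaced hS hfa hrec hY
  exact ⟨g ∘ f, R', Z, hf.comp hg, hfY.comp hgZ, hw⟩

/-- Along an isomorphism `R → R'` carrying `Q` to `Q'`, both `R` and `R'` map to a common well
placed pair by maps that extend to the normalizers. -/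
theorem IsSaturatedAt.exists_common [Fact p.Prime] [Finite S] (hS : IsPGroup p S)
    {R R' Q Q' : Subgroup G} {f : G → G} (h : F.IsSaturatedAt p R) (hf : F.MapsOnto f R R')
    (hfQ : F.MapsOnto f Q Q') (hQ : Q ≤ R) :
    ∃ R₀ Z, F.WellPlaced p R₀ Z ∧
      (∃ u N B, F.MapsOnto u N B ∧ F.MapsOnto u R R₀ ∧ F.MapsOnto u Q Z ∧
        S ⊓ normalizer (R : Set G) ⊓ normalizer (Q : Set G) ≤ N ∧ R ≤ N) ∧
      (∃ u N B, F.MapsOnto u N B ∧ F.MapsOnto u R' R₀ ∧ F.MapsOnto u Q' Z ∧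
        S ⊓ normalizer (R' : Set G) ⊓ normalizer (Q' : Set G) ≤ N ∧ R' ≤ N) := by
  obtain ⟨c, R₀, Z, hc, hcZ, hw⟩ := h.exists_wellPlaced hS hQ
  refine ⟨R₀, Z, hw, hw.exists_extension_normalizer hS hc hcZ hQ, ?_⟩
  obtain ⟨g, hg, hgf, hfg⟩ := hf.symm
  have hQ' : Q' ≤ R' := hfQ.target_le_of_forall fun x hx => hf.mem (hQ hx)
  have hgQ : F.MapsOnto g Q' Q := hg.restrict_of_mem_iff hQ' hQ fun x hx => by
    rw [← hf.mem_iff hfQ hQ (hg.mem hx), hfg x hx]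
  exact hw.exists_extension_normalizer hS (hg.comp hc) (hgQ.comp hcZ) hQ'

/-- Some isomorphism `Q → Q'` extends to the normalizer of `Q`. -/
def Arrow (F : FusionSystem S) (Q Q' : Subgroup G) : Prop :=
  ∃ f B, F.MapsOnto f (S ⊓ normalizer (Q : Set G)) B ∧ F.MapsOnto f Q Q'

theorem le_normIn {Q : Subgroup G} (hQ : Q ≤ S) : Q ≤ S ⊓ normalizer (Q : Set G) :=
  le_inf hQ le_normalizer

theorem MapsOnto.le_normIn {Q Q' N B : Subgroup G} {f : G → G} (h : F.MapsOnto f N B)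
    (hQ : F.MapsOnto f Q Q') (hQN : Q ≤ N) (hN : N ≤ normalizer (Q : Set G)) :
    B ≤ S ⊓ normalizer (Q' : Set G) :=
  h.target_le_of_forall fun _ hx => ⟨h.target_le (h.mem hx), h.mem_normalizer hQ hQN hx (hN hx)⟩

theorem MapsOnto.arrow {Q Q' N B : Subgroup G} {f : G → G} (h : F.MapsOnto f N B)
    (hN : S ⊓ normalizer (Q : Set G) ≤ N) (hQ : F.MapsOnto f Q Q') : F.Arrow Q Q' := by
  obtain ⟨B', -, hB'⟩ := h.restrict hN
  exact ⟨f, B', hB', hQ⟩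

theorem Arrow.isConj {Q Q' : Subgroup G} (h : F.Arrow Q Q') : F.IsConj Q Q' := by
  obtain ⟨f, B, -, h⟩ := h
  exact h.isConj

theorem Arrow.trans {Q Q' Q'' : Subgroup G} (h : F.Arrow Q Q') (h' : F.Arrow Q' Q'') :
    F.Arrow Q Q'' := by
  obtain ⟨f, B, hB, hQ⟩ := h
  obtain ⟨g, C, hC, hQ'⟩ := h'
  obtain ⟨D, -, hD⟩ := hC.restrict (hB.le_normIn hQ (le_normIn hQ.source_le) inf_le_right)
  exact ⟨g ∘ f, D, hB.comp hD, hQ.comp hQ'⟩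

theorem Arrow.card_le [Finite S] {Q Q' : Subgroup G} (h : F.Arrow Q Q') :
    Nat.card (S ⊓ normalizer (Q : Set G) : Subgroup G) ≤
      Nat.card (S ⊓ normalizer (Q' : Set G) : Subgroup G) := by
  obtain ⟨f, B, hB, hQ⟩ := h
  rw [hB.card_eq]
  exact card_le_card_of_le (hB.le_normIn hQ (le_normIn hQ.source_le) inf_le_right) inf_le_left

theorem Arrow.mapsOnto_of_card_le [Finite S] {Q Q' B : Subgroup G} {f : G → G}
    (hB : F.MapsOnto f (S ⊓ normalizer (Q : Set G)) B) (hQ : F.MapsOnto f Q Q')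
    (hc : Nat.card (S ⊓ normalizer (Q' : Set G) : Subgroup G) ≤
      Nat.card (S ⊓ normalizer (Q : Set G) : Subgroup G)) :
    F.MapsOnto f (S ⊓ normalizer (Q : Set G)) (S ⊓ normalizer (Q' : Set G)) := by
  have : B = S ⊓ normalizer (Q' : Set G) :=
    eq_of_le_of_card_le (hB.le_normIn hQ (le_normIn hQ.source_le) inf_le_right) inf_le_left
      (hB.card_eq ▸ hc)
  exact this ▸ hB

theorem MapsOnto.symm_restrict {f g : G → G} {P Q P' Q' : Subgroup G} (h : F.MapsOnto f P Q)
    (h' : F.MapsOnto f P' Q') (hP : P' ≤ P) (hg : F.MapsOnto g Q P)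
    (hgf : ∀ x ∈ P, g (f x) = x) : F.MapsOnto g Q' P' := by
  refine hg.restrict_of_mem_iff (h'.target_le_of_forall fun x hx => h.mem (hP hx)) hP ?_
  intro y hy
  obtain ⟨x, hx, rfl⟩ := h.surj hy
  rw [hgf x hx]
  exact h.mem_iff h' hP hx

/-- An arrow embeds `N_S(Q)` into `N_S(Q')`; if the latter is no larger, the embedding is onto and
can be inverted. -/
theorem Arrow.symm_of_card_le [Finite S] {Q Q' : Subgroup G} (h : F.Arrow Q Q')
    (hc : Nat.card (S ⊓ normalizer (Q' : Set G) : Subgroup G) ≤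
      Nat.card (S ⊓ normalizer (Q : Set G) : Subgroup G)) : F.Arrow Q' Q := by
  obtain ⟨f, B, hB, hQ⟩ := h
  have hB' := Arrow.mapsOnto_of_card_le hB hQ hc
  obtain ⟨g, hg, hgf, -⟩ := hB'.symm
  exact ⟨g, _, hg, hB'.symm_restrict hQ (le_normIn hQ.source_le) hg hgf⟩

theorem lt_normalizer_inf [Fact p.Prime] [Finite S] (hS : IsPGroup p S) {R Q : Subgroup G}
    (h : R < S ⊓ normalizer (Q : Set G)) :
    R < S ⊓ normalizer (R : Set G) ⊓ normalizer (Q : Set G) := by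
  have : Finite (S ⊓ normalizer (Q : Set G) : Subgroup G) :=
    Finite.of_injective _ (inclusion_injective inf_le_left)
  obtain ⟨m, hm, hmR, hmn⟩ := exists_mem_normalizer_of_lt (hS.to_le inf_le_left) h
  refine lt_of_le_of_ne (le_inf (le_normIn (h.le.trans inf_le_left)) (h.le.trans inf_le_right))
    fun heq => hmR ?_
  rw [heq]
  exact ⟨⟨hm.1, hmn⟩, hm.2⟩

/-- A diamond argument by downward induction on `|R|`. Both `R` and `R'` map to a well placed `(R₀,
Z)` by maps defined on larger groups, unless they already are the full normalizers of `Q` and `Q'`.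
Then either one has arrows to `Z`, or the induction hypothesis applies to these larger groups. The
counter `k` bounds `|S| - |R|`. -/
theorem exists_arrow_of_mapsOnto [Fact p.Prime] [Finite S] (hS : IsPGroup p S)
    {C : Set (Subgroup G)} (hC : ∀ P ∈ C, ∀ Q, F.IsConj P Q → Q ∈ C)
    (hsat : ∀ Q ∈ C, ∀ R ≤ S, Q < R → F.IsSaturatedAt p R) (k : ℕ) :
    ∀ {R R' Q Q' : Subgroup G} {f : G → G}, Nat.card S < k + Nat.card R → Q ∈ C → Q < R →
      R ≤ S ⊓ normalizer (Q : Set G) → F.MapsOnto f R R' → F.MapsOnto f Q Q' →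
      ∃ W, F.Arrow Q W ∧ F.Arrow Q' W := by
  induction k with
  | zero =>
    intro R R' Q Q' f hk _ _ hR
    have := card_le_card_of_le (S := S) (hR.trans inf_le_left) le_rfl
    omega
  | succ k ih =>
    intro R R' Q Q' f hk hQC hQR hR hf hfQ
    obtain ⟨R₀, Z, hw, ⟨u, N, B, hu, huR, huQ, huN, -⟩, ⟨u', N', B', hu', huR', huQ', huN', -⟩⟩ :=
      (hsat Q hQC R (hR.trans inf_le_left) hQR).exists_common hS hf hfQ hQR.le
    have hZC : Z ∈ C := hC Q hQC Z huQ.isConj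
    have hQ'C : Q' ∈ C := hC Q hQC Q' hfQ.isConj
    have hQR' : Q' < R' := by
      have hle : Q' ≤ R' := hfQ.target_le_of_forall fun x hx => hf.mem (hQR.le hx)
      refine lt_of_le_of_ne hle fun heq => hQR.ne ?_
      refine eq_of_le_of_card_le hQR.le hf.source_le ?_
      rw [hf.card_eq, hfQ.card_eq, heq]
    have hR' : R' ≤ S ⊓ normalizer (Q' : Set G) :=
      hf.le_normIn hfQ hQR.le (hR.trans inf_le_right)
    have step : ∀ {R Q : Subgroup G} {u : G → G} {N B : Subgroup G}, Nat.card S < k + 1 + Nat.card R →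
        Q ∈ C → Q < R → R ≤ S ⊓ normalizer (Q : Set G) → F.MapsOnto u N B → F.MapsOnto u R R₀ →
        F.MapsOnto u Q Z → S ⊓ normalizer (R : Set G) ⊓ normalizer (Q : Set G) ≤ N →
        F.Arrow Q Z ∨ ((∃ W, F.Arrow Q W ∧ F.Arrow Z W) ∧
          Nat.card R < Nat.card (S ⊓ normalizer (Z : Set G) : Subgroup G)) := by
      intro R Q u N B hk hQC hQR hR hu huR huQ huN
      rcases eq_or_lt_of_le hR with heq | hlt
      · left
        refine hu.arrow (le_trans ?_ huN) huQ
        rw [← heq]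
        exact le_inf (le_normIn (hR.trans inf_le_left)) (hR.trans inf_le_right)
      · right
        have hlt' := lt_normalizer_inf hS hlt
        obtain ⟨B', -, hB'⟩ := hu.restrict huN
        have hM : S ⊓ normalizer (R : Set G) ⊓ normalizer (Q : Set G) ≤ S :=
          inf_le_left.trans inf_le_left
        have hc := card_lt_card_of_lt hlt' hM
        refine ⟨ih (by omega) hQC (hQR.trans hlt') (le_inf hM inf_le_right) hB' huQ, ?_⟩
        refine hc.trans_le ?_
        rw [hB'.card_eq]
        exact card_le_card_of_le (hB'.le_normIn huQ (hQR.trans hlt').le inf_le_right) inf_le_left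
    have hcR := hf.card_eq
    rcases step hk hQC hQR hR hu huR huQ huN with h1 | ⟨⟨W, hQW, hZW⟩, hc⟩
    · rcases step (hcR ▸ hk) hQ'C hQR' hR' hu' huR' huQ' huN' with h2 | ⟨⟨W', hQW', hZW'⟩, -⟩
      · exact ⟨Z, h1, h2⟩
      · exact ⟨W', h1.trans hZW', hQW'⟩
    · rcases step (hcR ▸ hk) hQ'C hQR' hR' hu' huR' huQ' huN' with h2 | ⟨⟨W', hQW', hZW'⟩, -⟩
      · exact ⟨W, hQW, h2.trans hZW⟩
      -- Two arrows `g`, `g'` leave `Z`. The isomorphism `g' ∘ g⁻¹` from `W` to its image is defined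
      -- on `D = g(N_S(Z))`, which is larger than `R`, so induction joins `W` and `W'`.
      · obtain ⟨g, D, hg, hgZ⟩ := hZW
        obtain ⟨g', D', hg', hgZ'⟩ := hZW'
        obtain ⟨i, hi, hig, -⟩ := hg.symm
        have hZn := le_normIn hgZ.source_le
        have hiZ := hg.symm_restrict hgZ hZn hi hig
        have hWC : W ∈ C := hC Z hZC W hgZ.isConj
        have hcW : Nat.card W < Nat.card D := by
          rw [← hg.card_eq, ← hgZ.card_eq, ← huQ.card_eq]
          exact (card_lt_card_of_lt hQR hf.source_le).trans hc
        have hWD : W ≤ D := hgZ.target_le_of_forall fun x hx => hg.mem (hZn hx)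
        obtain ⟨V, hV, hV'⟩ := ih (by rw [← hg.card_eq]; omega) hWC
          (lt_of_le_of_ne hWD fun h => by rw [h] at hcW; exact lt_irrefl _ hcW)
          (hg.le_normIn hgZ hZn inf_le_right) (hi.comp hg') (hiZ.comp hgZ')
        exact ⟨V, hQW.trans hV, hQW'.trans hV'⟩

/-- Since `Z < S`, the group `N_S(Z)` properly contains `Z`, so the inverse of one arrow followed by
the other is a restriction from a proper overgroup of `W`, and the diamond argument applies. This
gives transitivity of having a common target. -/
theorem exists_arrow_of_arrow [Fact p.Prime] [Finite S] (hS : IsPGroup p S)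
    {C : Set (Subgroup G)} (hC : ∀ P ∈ C, ∀ Q, F.IsConj P Q → Q ∈ C)
    (hsat : ∀ Q ∈ C, ∀ R ≤ S, Q < R → F.IsSaturatedAt p R) (hSC : S ∉ C)
    {Z W W' : Subgroup G} (hZ : Z ∈ C) (h : F.Arrow Z W) (h' : F.Arrow Z W') :
    ∃ V, F.Arrow W V ∧ F.Arrow W' V := by
  obtain ⟨g, D, hg, hgZ⟩ := h
  obtain ⟨g', D', hg', hgZ'⟩ := h'
  obtain ⟨i, hi, hig, -⟩ := hg.symm
  have hZn := le_normIn hgZ.source_le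
  have hiZ := hg.symm_restrict hgZ hZn hi hig
  have hWC : W ∈ C := hC Z hZ W hgZ.isConj
  have hZS : Z < S := lt_of_le_of_ne hgZ.source_le fun h => hSC (h ▸ hZ)
  obtain ⟨m, hm, hmZ, hmn⟩ := exists_mem_normalizer_of_lt hS hZS
  have hcZ : Nat.card Z < Nat.card (S ⊓ normalizer (Z : Set G) : Subgroup G) := by
    refine card_lt_card_of_lt (S := S) (lt_of_le_of_ne hZn fun h => hmZ ?_) inf_le_left
    rw [h]
    exact ⟨hm, hmn⟩
  have hcW : Nat.card W < Nat.card D := by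
    rwa [← hg.card_eq, ← hgZ.card_eq]
  have hWD : W ≤ D := hgZ.target_le_of_forall fun x hx => hg.mem (hZn hx)
  exact exists_arrow_of_mapsOnto hS hC hsat (Nat.card S + 1) (by omega) hWC
    (lt_of_le_of_ne hWD fun h => by rw [h] at hcW; exact lt_irrefl _ hcW)
    (hg.le_normIn hgZ hZn inf_le_right) (hi.comp hg') (hiZ.comp hgZ')

theorem exists_normalizing_restriction [Fact p.Prime] [Finite S] (hS : IsPGroup p S)
    {R Q : Subgroup G} (hR : R ≤ S) (h : Q < R) :
    Q < R ⊓ normalizer (Q : Set G) := by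
  have : Finite R := Finite.of_injective _ (inclusion_injective hR)
  obtain ⟨m, hm, hmQ, hmn⟩ := exists_mem_normalizer_of_lt (hS.to_le hR) h
  refine lt_of_le_of_ne (le_inf h.le le_normalizer) fun heq => hmQ ?_
  rw [heq]
  exact ⟨hm, hmn⟩

/-- Induction along a product of restrictions: a relation between the members of a conjugacy
class, labelled by morphisms, holds for restrictions of all morphisms as soon as it holds for
restrictions of morphisms between strictly larger subgroups normalizing the source, and is
transitive. -/
theorem IsGeneratedBy.induction_on [Fact p.Prime] [Finite S] (hS : IsPGroup p S)
    {Δ C : Set (Subgroup G)} (hgen : F.IsGeneratedBy Δ) (hC : ∀ P ∈ C, ∀ Q, F.IsConj P Q → Q ∈ C)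
    (hCΔ : ∀ P ∈ C, P ∉ Δ)
    {r : (G → G) → Subgroup G → Subgroup G → Prop}
    (hcongr : ∀ {f g : G → G} {Q Q'}, (∀ x ∈ Q, g x = f x) → r f Q Q' → r g Q Q')
    (hstep : ∀ {f : G → G} {R R' Q Q'}, Q ∈ C → Q < R → R ≤ S ⊓ normalizer (Q : Set G) →
      F.MapsOnto f R R' → F.MapsOnto f Q Q' → r f Q Q')
    (htrans : ∀ {f g : G → G} {Q Q' Q''}, Q ∈ C → F.MapsOnto f Q Q' → F.MapsOnto g Q' Q'' →
      r f Q Q' → r g Q' Q'' → r (g ∘ f) Q Q'')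
    {f : G → G} {Q Q' : Subgroup G} (hQ : Q ∈ C) (hf : F.MapsOnto f Q Q') : r f Q Q' := by
  have key : ∀ {P P' : Subgroup G} {φ : P →* P'}, F.ProductOfRestrictions Δ φ →
      ∀ Q ∈ C, ∀ hQP : Q ≤ P, ∃ f Q', F.MapsOnto f Q Q' ∧ r f Q Q' ∧
        ∀ x (hx : x ∈ P), x ∈ Q → f x = φ ⟨x, hx⟩ := by
    intro P P' φ h
    induction h with
    | @restriction P P' R R' φ ψ hR hR' hψ hres =>
      intro Q hQ hQP
      obtain ⟨-, hPR, hφψ⟩ := hres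
      obtain ⟨f, R₁, -, hf, hfψ⟩ := exists_mapsOnto_of_hom hψ
      -- Members of the class are outside `Δ` while `R` is in `Δ`; this makes the overgroup proper,
      -- so that `R ∩ N(Q)` still properly contains `Q`.
      have hQR : Q < R := lt_of_le_of_ne (hQP.trans hPR) fun h => hCΔ Q hQ (h ▸ hR)
      have hlt := exists_normalizing_restriction hS hf.source_le hQR
      obtain ⟨Q', -, hfQ⟩ := hf.restrict hQR.le
      obtain ⟨M, -, hfM⟩ := hf.restrict (P' := R ⊓ normalizer (Q : Set G)) inf_le_left
      refine ⟨f, Q', hfQ, hstep hQ hlt (inf_le_inf_right _ hf.source_le) hfM hfQ, ?_⟩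
      intro x hx _
      rw [← hφψ ⟨x, hx⟩, hfψ]
      rfl
    | @comp P P₁ P₂ φ ψ hφ hψ ih ih' =>
      intro Q hQ hQP
      obtain ⟨f, Q₁, hf, hr, hfφ⟩ := ih Q hQ hQP
      have hQ₁ : Q₁ ≤ P₁ := hf.target_le_of_forall fun x hx => by
        rw [hfφ x (hQP hx) hx]
        exact (φ _).2
      obtain ⟨g, Q₂, hg, hr', hgψ⟩ := ih' Q₁ (hC Q hQ Q₁ hf.isConj) hQ₁
      refine ⟨g ∘ f, Q₂, hf.comp hg, htrans hQ hf hg hr hr', fun x hx hxQ => ?_⟩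
      have h1 := hf.mem hxQ
      rw [Function.comp_apply, hgψ (f x) (hQ₁ h1) h1]
      have h2 : (⟨f x, hQ₁ h1⟩ : P₁) = φ ⟨x, hx⟩ := Subtype.ext (hfφ x hx hxQ)
      rw [h2]
      rfl
  obtain ⟨e, he, hef⟩ := hf
  have hf : F.MapsOnto f Q Q' := ⟨e, he, hef⟩
  obtain ⟨g, Q₁, hg, hr, hgf⟩ := key (hgen _ _ _ he.1) Q hQ le_rfl
  have hfg : ∀ x ∈ Q, f x = g x := fun x hx => by
    rw [hgf x hx hx]
    exact (hef ⟨x, hx⟩).symm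
  have : Q₁ = Q' := (hg.congr hfg).target_unique hf
  exact hcongr hfg (this ▸ hr)

/-- A conjugacy class outside `Δ` all of whose proper overgroups are saturated contains a member to
which all members map by isomorphisms extending to the normalizers. -/
theorem exists_arrow_of_isConj [Fact p.Prime] [Finite S] (hS : IsPGroup p S)
    {Δ C : Set (Subgroup G)} (hgen : F.IsGeneratedBy Δ) (hC : ∀ P ∈ C, ∀ Q, F.IsConj P Q → Q ∈ C)
    (hCΔ : ∀ P ∈ C, P ∉ Δ) (hSC : S ∉ C)
    (hsat : ∀ Q ∈ C, ∀ R ≤ S, Q < R → F.IsSaturatedAt p R)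
    {P Q : Subgroup G} (hQ : Q ∈ C) (h : F.IsConj Q P)
    (hP : ∀ W, F.IsConj P W → Nat.card (S ⊓ normalizer (W : Set G) : Subgroup G) ≤
      Nat.card (S ⊓ normalizer (P : Set G) : Subgroup G)) : F.Arrow Q P := by
  obtain ⟨f, hf⟩ := h.exists_mapsOnto
  obtain ⟨W, hQW, hPW⟩ := hgen.induction_on hS hC hCΔ
    (r := fun _ Q P => ∃ W, F.Arrow Q W ∧ F.Arrow P W) (fun _ h => h)
    (fun hQ hlt hR hf hfQ => exists_arrow_of_mapsOnto hS hC hsat (Nat.card S + 1) (by omega)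
      hQ hlt hR hf hfQ)
    (fun {f g Q Q' Q''} hQ hf hg h h' => by
      obtain ⟨W, h1, h2⟩ := h
      obtain ⟨W', h1', h2'⟩ := h'
      obtain ⟨V, hV, hV'⟩ := exists_arrow_of_arrow hS hC hsat hSC (hC Q hQ Q' hf.isConj) h2 h1'
      exact ⟨V, h1.trans hV, h2'.trans hV'⟩) hQ hf
  -- `P` has the largest normalizer, so its arrow to the common target `W` is reversible.
  exact hQW.trans (hPW.symm_of_card_le (hP W hPW.isConj))

end FusionSystem

/-! ### The preimage of the p-core in the normalizer, and extension of automorphisms to it -/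

namespace FusionSystem

variable {G : Type*} [Group G] {S : Subgroup G} {F : FusionSystem S} {p : ℕ}

/-- `e` is only required to conjugate one automorphism group to the other, not to be a morphism of
`F`. This allows transporting cores of an invariant subsystem along isomorphisms of the larger
system. -/
theorem CoreAct.transport_of_equiv {P P' : Subgroup G} (hP' : P' ≤ S) {f g : G → G} (e : P ≃* P')
    (he : ∀ (hP : P ≤ S) a, a ∈ F.aut P hP ↔ MulAut.congr e a ∈ F.aut P' hP')
    (h : F.CoreAct p P f) {θ : G → G} (hθ : ∀ x : P, (e x : G) = θ x)
    (hfg : ∀ x ∈ P, g (θ x) = θ (f x)) : F.CoreAct p P' g := by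
  obtain ⟨hP, b, hb, hbf⟩ := h
  refine ⟨hP', _, map_mem_pCore (MulAut.congr e) (he hP) hb, fun y => ?_⟩
  obtain ⟨x, rfl⟩ := e.surjective y
  change (e (b (e.symm (e x))) : G) = _
  rw [e.symm_apply_apply, hθ, hθ, hfg x x.2, hbf]

theorem congr_mem_aut_iff {P P' : Subgroup G} {e : P ≃* P'} (he : e ∈ F.Iso P P') (hP : P ≤ S)
    (hP' : P' ≤ S) (a : MulAut P) : a ∈ F.aut P hP ↔ MulAut.congr e a ∈ F.aut P' hP' := by
  have key : ∀ {P P' : Subgroup G} {e : P ≃* P'} (_ : e ∈ F.Iso P P') (hP : P ≤ S)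
      (hP' : P' ≤ S) (a : MulAut P), a ∈ F.aut P hP → MulAut.congr e a ∈ F.aut P' hP' := by
    intro P P' e he hP hP' a ha
    exact ⟨F.comp_mem (F.comp_mem he.2 ha.1) he.1, F.comp_mem (F.comp_mem he.2 ha.2) he.1⟩
  refine ⟨key he hP hP' a, fun h => ?_⟩
  have := key (e := e.symm) ⟨he.2, he.1⟩ hP' hP _ h
  have h2 : MulAut.congr e.symm (MulAut.congr e a) = a := MulEquiv.ext fun x => by
    change e.symm (e (a (e.symm (e x)))) = a x
    simp
  rwa [h2] at this

theorem CoreAct.transport {P P' : Subgroup G} {f g θ : G → G} (h : F.CoreAct p P f)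
    (hθ : F.MapsOnto θ P P') (hfg : ∀ x ∈ P, g (θ x) = θ (f x)) : F.CoreAct p P' g := by
  obtain ⟨e, he, heθ⟩ := hθ
  exact h.transport_of_equiv (F.source_le he.2) e (fun hP => congr_mem_aut_iff he hP _) heθ hfg

/-- The elements of `N_S(P)` that act on `P` as elements of the largest normal `p`-subgroup of
`Aut_F(P)`. -/
def coreIn (F : FusionSystem S) (p : ℕ) (P : Subgroup G) (hP : P ≤ S) : Subgroup G :=
  S ⊓ ((pCore p (F.aut P hP)).comap P.normalizerMonoidHom).map (normalizer (P : Set G)).subtype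

theorem mem_coreIn_iff {P : Subgroup G} {hP : P ≤ S} {y : G} : y ∈ F.coreIn p P hP ↔
    y ∈ S ⊓ normalizer (P : Set G) ∧ F.CoreAct p P (fun x => y * x * y⁻¹) := by
  constructor
  · rintro ⟨hy, n, hn, rfl⟩
    exact ⟨⟨hy, n.2⟩, hP, _, hn, fun x => rfl⟩
  · rintro ⟨hy, hP', b, hb, hby⟩
    refine ⟨hy.1, ⟨y, hy.2⟩, ?_, rfl⟩
    have : P.normalizerMonoidHom ⟨y, hy.2⟩ = b := MulEquiv.ext fun x => Subtype.ext (hby x).symm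
    exact mem_comap.2 (this ▸ hb)

theorem coreIn_le {P : Subgroup G} {hP : P ≤ S} : F.coreIn p P hP ≤ S ⊓ normalizer (P : Set G) :=
  fun _ hy => (mem_coreIn_iff.1 hy).1

theorem MapsOnto.mem_coreIn_iff {P P' R R' : Subgroup G} {θ : G → G} (h : F.MapsOnto θ R R')
    (hP : F.MapsOnto θ P P') (hPR : P ≤ R) {y : G} (hy : y ∈ R) :
    y ∈ F.coreIn p P hP.source_le ↔ θ y ∈ F.coreIn p P' hP.target_le := by
  have key : ∀ {P P' R R' : Subgroup G} {θ : G → G} (_ : F.MapsOnto θ R R')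
      (hP : F.MapsOnto θ P P') (_ : P ≤ R) {y : G} (_ : y ∈ R),
      y ∈ F.coreIn p P hP.source_le → θ y ∈ F.coreIn p P' hP.target_le := by
    intro P P' R R' θ h hP hPR y hy hyP
    obtain ⟨hyn, hyc⟩ := FusionSystem.mem_coreIn_iff.1 hyP
    refine FusionSystem.mem_coreIn_iff.2 ⟨⟨h.target_le (h.mem hy),
      h.mem_normalizer hP hPR hy hyn.2⟩, hyc.transport hP fun x hx => ?_⟩
    exact (h.map_conj hy (hPR hx)).symm
  refine ⟨key h hP hPR hy, fun hθ => ?_⟩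
  obtain ⟨g, hg, hgθ, -⟩ := h.symm
  have hgP := h.symm_restrict hP hPR hg hgθ
  have hP'R : P' ≤ R' := hP.target_le_of_forall fun x hx => h.mem (hPR hx)
  have := key hg hgP hP'R (h.mem hy) hθ
  rwa [hgθ y hy] at this

/-- Inner automorphisms form a normal `p`-subgroup of `Aut_F(P)`. -/
theorem le_coreIn (hS : IsPGroup p S) {P : Subgroup G} (hP : P ≤ S) : P ≤ F.coreIn p P hP := by
  intro y hy
  refine mem_coreIn_iff.2 ⟨le_normIn hP hy, hP, MulAut.conj ⟨y, hy⟩, ?_, fun x => rfl⟩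
  refine mem_pCore_of_mem (N := (MulAut.conj (G := P)).range) ?_ ?_ ?_ ⟨⟨y, hy⟩, rfl⟩
  · rintro _ ⟨z, rfl⟩
    exact mem_aut_of_mapsOnto (mapsOnto_conj hP (hP z.2) (le_normalizer z.2)) fun x => rfl
  · rintro g - _ ⟨z, rfl⟩
    refine ⟨g z, MulEquiv.ext fun x => ?_⟩
    change g z * x * (g z)⁻¹ = g (z * (g⁻¹ x) * z⁻¹)
    rw [map_mul, map_mul, map_inv, MulAut.apply_inv_self]
  · rw [MonoidHom.range_eq_map]
    exact ((hS.to_le hP).of_equiv (topEquiv (G := P)).symm).map _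

theorem normalizer_le_normalizer_coreIn [Finite S] {P : Subgroup G} (hP : P ≤ S) :
    S ⊓ normalizer (P : Set G) ≤ normalizer (F.coreIn p P hP : Set G) := by
  intro s hs
  have : Finite (F.coreIn p P hP) :=
    Finite.of_injective _ (inclusion_injective (coreIn_le.trans inf_le_left))
  refine mem_normalizer_of_conj_mem fun y hy => ?_
  have h := mapsOnto_conj (F := F) (P := S ⊓ normalizer (P : Set G)) inf_le_left hs.1
    (le_normalizer hs)
  exact (h.mem_coreIn_iff (mapsOnto_conj hP hs.1 hs.2) (le_normIn hP) (coreIn_le hy)).1 hy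

/-- Normalizers grow in the `p`-group `PK`; an element of `N_{PK}(P)` outside `P` has the form `a k`
with `a ∈ P`, and `k` is as required. -/
theorem exists_mem_normalizer_of_le_normalizer [Fact p.Prime] [Finite S] (hS : IsPGroup p S)
    {P K : Subgroup G} (hP : P ≤ S) (hK : K ≤ S) (hPK : P ≤ normalizer (K : Set G))
    (h : ¬ K ≤ P) : ∃ k ∈ K, k ∉ P ∧ k ∈ normalizer (P : Set G) := by
  have hle : P ⊔ K ≤ S := sup_le hP hK
  have : Finite (P ⊔ K : Subgroup G) := Finite.of_injective _ (inclusion_injective hle)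
  obtain ⟨m, hm, hmP, hmn⟩ := exists_mem_normalizer_of_lt (hS.to_le hle)
    (lt_of_le_of_ne le_sup_left fun heq => h (heq ▸ le_sup_right))
  have hm' : m ∈ ((P ⊔ K : Subgroup G) : Set G) := hm
  rw [coe_mul_of_left_le_normalizer_right P K hPK] at hm'
  obtain ⟨a, ha, k, hk, rfl⟩ := hm'
  refine ⟨k, hk, fun hkP => hmP (P.mul_mem ha hkP), ?_⟩
  have := mul_mem (inv_mem (le_normalizer ha)) hmn
  rwa [inv_mul_cancel_left] at this

/-- The automorphism of `P` given by `f` extends to `K`. -/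
def ExtendsTo (F : FusionSystem S) (K P : Subgroup G) (f : G → G) : Prop :=
  ∃ g, F.MapsOnto g K K ∧ ∀ x ∈ P, g x = f x

/-- Downward induction on `|R|`. With `K = coreIn P`, if `K ≤ R` then `f` itself preserves `K`.
Otherwise, for a well placed `(R₀, Z)` and an arrow `h` from `Z` to `P`, factor `f` on `P` as `(h
u')⁻¹ (h τ h⁻¹) (h u)` with `τ = u' f u⁻¹` on `R₀`. Each factor, or its inverse, comes from a
subgroup larger than `R`, hence extends to `K` by induction. -/
theorem extendsTo_coreIn_of_mapsOnto [Fact p.Prime] [Finite S] (hS : IsPGroup p S)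
    {P : Subgroup G} (hP : P ≤ S) (hmax : ∀ Q, F.IsConj P Q → F.Arrow Q P)
    (hsat : ∀ R ≤ S, P < R → F.IsSaturatedAt p R) (k : ℕ) :
    ∀ {R R' : Subgroup G} {f : G → G}, Nat.card S < k + Nat.card R → P < R →
      R ≤ S ⊓ normalizer (P : Set G) → F.MapsOnto f R R' → F.MapsOnto f P P →
      F.ExtendsTo (F.coreIn p P hP) P f := by
  induction k with
  | zero =>
    intro R R' f hk _ hR
    have := card_le_card_of_le (S := S) (hR.trans inf_le_left) le_rfl
    omega
  | succ k ih =>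
    intro R R' f hk hPR hR hf hfP
    have hPR' : P ≤ R' := hfP.target_le_of_forall fun x hx => hf.mem (hPR.le hx)
    have hKS : F.coreIn p P hP ≤ S := coreIn_le.trans inf_le_left
    by_cases hKR : F.coreIn p P hP ≤ R
    · obtain ⟨K, -, hK⟩ := hf.restrict hKR
      have hle : K ≤ F.coreIn p P hP := hK.target_le_of_forall fun x hx =>
        (hf.mem_coreIn_iff hfP hPR.le (hKR hx)).1 hx
      have heq := eq_of_le_of_card_le hle hKS hK.card_eq.le
      exact ⟨f, heq ▸ hK, fun _ _ => rfl⟩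
    have hRlt : R < S ⊓ normalizer (P : Set G) := lt_of_le_of_ne hR fun h => hKR (h ▸ coreIn_le)
    have hR' : R' ≤ S ⊓ normalizer (P : Set G) := hf.le_normIn hfP hPR.le (hR.trans inf_le_right)
    have hRlt' : R' < S ⊓ normalizer (P : Set G) := by
      refine lt_of_le_of_ne hR' fun h => ?_
      have h1 := card_lt_card_of_lt hRlt inf_le_left
      rw [hf.card_eq, h] at h1
      exact lt_irrefl _ h1
    obtain ⟨R₀, Z, hw, ⟨u, N, B, hu, huR, huP, huN, huRN⟩, ⟨u', N', B', hu', huR', huP', huN', -⟩⟩ :=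
      (hsat R hf.source_le hPR).exists_common hS hf hfP hPR.le
    obtain ⟨h, C, hh, hhZ⟩ := hmax Z huP.isConj
    have hZn := le_normIn hhZ.source_le
    have hC : C ≤ S ⊓ normalizer (P : Set G) := hh.le_normIn hhZ hZn inf_le_right
    have hR₀ : R₀ ≤ S ⊓ normalizer (Z : Set G) := huR.le_normIn huP hPR.le (hR.trans inf_le_right)
    -- isomorphisms from larger subgroups to `R₀`, composed with the arrow `h`
    have ext_comp : ∀ {R N B : Subgroup G} {u : G → G}, Nat.card S < k + 1 + Nat.card R → P < R →
        R < S ⊓ normalizer (P : Set G) → F.MapsOnto u N B → F.MapsOnto u P Z →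
        S ⊓ normalizer (R : Set G) ⊓ normalizer (P : Set G) ≤ N →
        F.ExtendsTo (F.coreIn p P hP) P (h ∘ u) := by
      intro R N B u hk hPR hRlt hu huP huN
      have hlt := lt_normalizer_inf hS hRlt
      have hM : S ⊓ normalizer (R : Set G) ⊓ normalizer (P : Set G) ≤ S :=
        inf_le_left.trans inf_le_left
      have hc := card_lt_card_of_lt hlt hM
      obtain ⟨D, -, hD⟩ := hu.restrict huN
      have hPM := hPR.trans hlt
      obtain ⟨D', -, hD'⟩ := hh.restrict (hD.le_normIn huP hPM.le inf_le_right)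
      exact ih (by omega) hPM (le_inf hM inf_le_right) (hD.comp hD') (huP.comp hhZ)
    have hcR := hf.card_eq
    obtain ⟨g₁, hg₁, hg₁u⟩ := ext_comp hk hPR hRlt hu huP huN
    have hPltR' : P < R' := by
      refine lt_of_le_of_ne hPR' fun heq => ?_
      have := card_lt_card_of_lt hPR hf.source_le
      rw [hcR, ← heq] at this
      exact lt_irrefl _ this
    obtain ⟨g₃, hg₃, hg₃u⟩ := ext_comp (hcR ▸ hk) hPltR' hRlt' hu' huP' huN'
    obtain ⟨j₃, hj₃, hj₃g, -⟩ := hg₃.symm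
    -- the automorphism of `R₀` corresponding to `f`
    obtain ⟨i, hi, hiu, hui⟩ := huR.symm
    have hiZ := huR.symm_restrict huP hPR.le hi hiu
    have hτ := (hi.comp hf).comp huR'
    have hτZ := (hiZ.comp hfP).comp huP'
    set τ := u' ∘ f ∘ i with hτdef
    obtain ⟨j, hj, hjτ, hτj⟩ := hτ.symm
    have hjZ := hτ.symm_restrict hτZ hw.1 hj hjτ
    -- `τ` need not extend beyond `R₀`. But elements of `coreIn Z` act on `Z` through the `p`-core,
    -- which `τ` normalizes, so their `τ`-conjugates act on `Z` as elements of `N_S(R₀) ∩ N_S(Z)`.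
    -- Thus `τ` can be changed, keeping its values on `Z`, to a map `v` that extends to `coreIn Z ∩
    -- N(R₀)`.
    obtain ⟨v, V, V', hv, hvR, hvτ, hV, hRV⟩ := hw.exists_extension hS hτ hτZ hw.1
      (N₀ := F.coreIn p Z hhZ.source_le ⊓ normalizer (R₀ : Set G))
      (fun n hn => ⟨⟨(coreIn_le hn.1).1, hn.2⟩, (coreIn_le hn.1).2⟩) (by
        intro n hn
        obtain ⟨hnZ, hnc⟩ := mem_coreIn_iff.1 hn.1
        have hcR₀ := (hj.comp (mapsOnto_conj hj.source_le hnZ.1 hn.2)).comp hτ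
        have hcZ := (hjZ.comp (mapsOnto_conj hjZ.source_le hnZ.1 hnZ.2)).comp hτZ
        obtain ⟨s, hs, hsn⟩ := hw.exists_conj_of_coreAct hcR₀ hcZ (hnc.transport hτZ fun x hx => by
          simp only [Function.comp_apply]
          rw [hjτ x (hw.1 hx)])
        refine ⟨s, hs, fun x hx => ?_⟩
        have := hsn (τ x) (hτZ.mem hx)
        simp only [Function.comp_apply] at this
        rw [hjτ x (hw.1 hx)] at this
        exact this)
    have hvZ : F.MapsOnto v Z Z := hτZ.congr hvτ
    -- The image of `y` under `u` witnesses that the domain of `v` within `N_S(Z)` is strictly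
    -- larger than `R₀`; here `coreIn P` not being contained in `R` is used.
    obtain ⟨y, hyK, hyR, hyn⟩ := exists_mem_normalizer_of_le_normalizer hS hf.source_le hKS
      (hR.trans (normalizer_le_normalizer_coreIn hP)) hKR
    have hyN : y ∈ N := huN ⟨⟨hKS hyK, hyn⟩, (coreIn_le hyK).2⟩
    have huyn : u y ∈ normalizer (R₀ : Set G) := hu.mem_normalizer huR huRN hyN hyn
    have huyK := (hu.mem_coreIn_iff huP (hPR.le.trans huRN) hyN).1 hyK
    have huyR : u y ∉ R₀ := fun hmem => hyR ((hu.mem_iff huR huRN hyN).1 hmem)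
    have hlt : R₀ < V ⊓ (S ⊓ normalizer (Z : Set G)) := by
      refine lt_of_le_of_ne (le_inf hRV hR₀) fun heq => huyR ?_
      rw [heq]
      exact ⟨hV ⟨huyK, huyn⟩, coreIn_le huyK⟩
    obtain ⟨q, hq, hqh, hhq⟩ := hh.symm
    have hqP := hh.symm_restrict hhZ hZn hq hqh
    obtain ⟨D, hD, hhD⟩ := hh.restrict (P' := V ⊓ (S ⊓ normalizer (Z : Set G))) inf_le_right
    have hqD := hh.symm_restrict hhD inf_le_right hq hqh
    obtain ⟨V₂, -, hvV⟩ := hv.restrict (P' := V ⊓ (S ⊓ normalizer (Z : Set G))) inf_le_left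
    have hZV : Z ≤ V ⊓ (S ⊓ normalizer (Z : Set G)) := hw.1.trans hlt.le
    obtain ⟨D₂, -, hhD₂⟩ := hh.restrict
      (hvV.le_normIn hvZ hZV (inf_le_right.trans inf_le_right))
    have hPD : P ≤ D := hhZ.target_le_of_forall fun x hx => hhD.mem (hZV hx)
    have hcD : Nat.card R < Nat.card D := by
      rw [← hhD.card_eq, huR.card_eq]
      exact card_lt_card_of_lt hlt (inf_le_right.trans inf_le_left)
    obtain ⟨g₂, hg₂, hg₂v⟩ := ih (by omega) (lt_of_le_of_ne hPD fun heq => by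
      have := card_le_card_of_le hPR.le hf.source_le
      rw [← heq] at hcD
      omega) (hD.trans hC) ((hqD.comp hvV).comp hhD₂) ((hqP.comp hvZ).comp hhZ)
    refine ⟨j₃ ∘ g₂ ∘ g₁, (hg₁.comp hg₂).comp hj₃, fun x hx => ?_⟩
    have hux := huP.mem hx
    have h1 : g₁ x = h (u x) := hg₁u x hx
    have h2 : g₂ (h (u x)) = h (u' (f x)) := by
      rw [hg₂v _ (hhZ.mem hux)]
      simp only [Function.comp_apply]
      rw [hqh _ (hZn hux), hvτ _ hux, hτdef]
      simp only [Function.comp_apply]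
      rw [hiu x (hPR.le hx)]
    have h3 : g₃ (f x) = h (u' (f x)) := hg₃u _ (hfP.mem hx)
    simp only [Function.comp_apply]
    rw [h1, h2, ← h3]
    exact hj₃g _ (le_coreIn hS hP (hfP.mem hx))

/-- Generation factors `f` through other members of the class, where no automorphism of `P` is
visible. The relation used in the induction therefore transports each step to `P` through arbitrary
arrows from its source and target. -/
theorem extendsTo_coreIn [Fact p.Prime] [Finite S] (hS : IsPGroup p S)
    {Δ : Set (Subgroup G)} (hgen : F.IsGeneratedBy Δ) {P : Subgroup G} (hP : P ≤ S)
    (hΔ : ∀ Q, F.IsConj P Q → Q ∉ Δ) (hmax : ∀ Q, F.IsConj P Q → F.Arrow Q P)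
    (hsat : ∀ R ≤ S, P < R → F.IsSaturatedAt p R) {f : G → G} (hf : F.MapsOnto f P P) :
    F.ExtendsTo (F.coreIn p P hP) P f := by
  have key := hgen.induction_on hS (C := {Q | F.IsConj P Q}) (fun Q hQ R hR => hQ.trans hR) hΔ
    (r := fun f Q Q' => ∀ h B h' B' w, F.MapsOnto h (S ⊓ normalizer (Q : Set G)) B →
      F.MapsOnto h Q P → F.MapsOnto h' (S ⊓ normalizer (Q' : Set G)) B' → F.MapsOnto h' Q' P →
      (∀ x ∈ Q, w (h x) = h' (f x)) → F.ExtendsTo (F.coreIn p P hP) P w)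
    (fun {f g Q Q'} hfg H h B h' B' w hB hQ hB' hQ' hw => H h B h' B' w hB hQ hB' hQ'
      fun x hx => by rw [hw x hx, hfg x hx]) ?_ ?_ (mapsOnto_id hP).isConj hf
  · exact key id _ id _ f (mapsOnto_id inf_le_left) (mapsOnto_id hP) (mapsOnto_id inf_le_left)
      (mapsOnto_id hP) fun _ _ => rfl
  · intro f R R' Q Q' hQC hlt hR hf hfQ h B h' B' w hB hQ hB' hQ' hw
    have hQn := le_normIn hQ.source_le
    obtain ⟨q, hq, hqh, hhq⟩ := hB.symm
    have hqP := hB.symm_restrict hQ hQn hq hqh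
    obtain ⟨D, hD, hhD⟩ := hB.restrict hR
    have hqD := hB.symm_restrict hhD hR hq hqh
    obtain ⟨D', -, hhD'⟩ := hB'.restrict (hf.le_normIn hfQ hlt.le (hR.trans inf_le_right))
    have hPD : P ≤ D := hQ.target_le_of_forall fun x hx => hhD.mem (hlt.le hx)
    have hc := card_lt_card_of_lt hlt hf.source_le
    rw [hQ.card_eq, hhD.card_eq] at hc
    obtain ⟨g, hg, hgw⟩ := extendsTo_coreIn_of_mapsOnto hS hP hmax hsat (Nat.card S + 1)
      (by omega) (lt_of_le_of_ne hPD fun h => by rw [h] at hc; exact lt_irrefl _ hc)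
      (hD.trans (hB.le_normIn hQ hQn inf_le_right)) ((hqD.comp hf).comp hhD')
      ((hqP.comp hfQ).comp hQ')
    refine ⟨g, hg, fun x hx => ?_⟩
    obtain ⟨z, hz, rfl⟩ := hQ.surj hx
    rw [hgw _ hx, hw z hz]
    simp only [Function.comp_apply]
    rw [hqh z (hQn hz)]
  · intro f g Q Q' Q'' hQC hf hg ihf ihg h B h' B' w hB hQ hB' hQ'' hw
    -- An arrow `h₁` from the intermediate group to `P` splits `h' g f h⁻¹` into `(h' g h₁⁻¹)(h₁ f
    -- h⁻¹)`, two automorphisms of `P` that extend.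
    obtain ⟨h₁, B₁, hB₁, hQ'⟩ := hmax Q' (hQC.trans hf.isConj)
    obtain ⟨q, hq, hqh, -⟩ := hQ.symm
    obtain ⟨q', hq', hqh', -⟩ := hQ'.symm
    obtain ⟨a, ha, haw⟩ := ihf h B h₁ B₁ (h₁ ∘ f ∘ q) hB hQ hB₁ hQ' fun x hx => by
      simp only [Function.comp_apply]
      rw [hqh x hx]
    obtain ⟨b, hb, hbw⟩ := ihg h₁ B₁ h' B' (h' ∘ g ∘ q') hB₁ hQ' hB' hQ'' fun x hx => by
      simp only [Function.comp_apply]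
      rw [hqh' x hx]
    refine ⟨b ∘ a, ha.comp hb, fun x hx => ?_⟩
    obtain ⟨z, hz, rfl⟩ := hQ.surj hx
    rw [hw z hz, Function.comp_apply, haw _ hx]
    simp only [Function.comp_apply]
    rw [hqh z hz, hbw _ (hQ'.mem (hf.mem hz))]
    simp only [Function.comp_apply]
    rw [hqh' _ (hf.mem hz)]

/-- If all automorphisms of `P` extend to `K`, where `(K, P)` is well placed and `N_S(P)`
normalizes `K`, then `P` is fully automized. -/
theorem WellPlaced.fullyAutomized [Fact p.Prime] [Finite S] {K P : Subgroup G}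
    (hw : F.WellPlaced p K P) (hPK : S ⊓ normalizer (P : Set G) ≤ normalizer (K : Set G))
    (hext : ∀ f, F.MapsOnto f P P → F.ExtendsTo K P f) : F.FullyAutomized p P := by
  obtain ⟨hle, hrec, hKS, hsyl⟩ := hw
  have hPS := hle.trans hKS
  have := finite_mulAut (S := S) hKS
  have : Finite P := Finite.of_injective _ (inclusion_injective hPS)
  obtain ⟨A, hA, -⟩ := hsyl.exists_sylow
  let φ : F.autStab K P hKS →* F.aut P hPS :=
    (F.resHom hKS hle).codRestrict _ fun a => resHom_mem_aut (hZ := hle) a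
  -- The extension hypothesis says exactly that restriction from the stabilizer is onto `Aut_F(P)`;
  -- a Sylow subgroup then maps to a Sylow subgroup, which is identified with `Aut_S(P)` below.
  have hφ : Function.Surjective φ := by
    rintro ⟨b, hb⟩
    obtain ⟨f, hf, hbf⟩ := exists_mapsOnto (F := F) (e := b) hb
    obtain ⟨g, hg, hgf⟩ := hext f hf
    obtain ⟨a, ha, hag⟩ := hg.exists_autStab (hf.congr hgf) hle hKS
    refine ⟨⟨a, ha⟩, Subtype.ext (MulEquiv.ext fun x => Subtype.ext ?_)⟩
    change (a (inclusion hle x) : G) = b x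
    rw [hag, hbf]
    exact hgf x x.2
  refine ⟨hPS, A.mapSurjective hφ, ?_⟩
  ext b
  constructor
  · rintro ⟨_, ⟨a, ha, rfl⟩, rfl⟩
    have ha' : a ∈ (autS S K ⊓ F.autStab K P hKS).subgroupOf (F.autStab K P hKS) := hA ▸ ha
    obtain ⟨s, hs, hsa⟩ := mem_autS_iff.1 (mem_subgroupOf.1 ha').1
    have hsP : ∀ x : P, ((φ a : MulAut P) x : G) = s * x * s⁻¹ := fun x => hsa (inclusion hle x)
    refine mem_autS_iff.2 ⟨s, ⟨hs.1, mem_normalizer_of_conj_mem fun x hx => ?_⟩, hsP⟩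
    rw [← hsP ⟨x, hx⟩]
    exact ((φ a : MulAut P) ⟨x, hx⟩).2
  · intro hb
    obtain ⟨s, hs, hsb⟩ := mem_autS_iff.1 hb
    obtain ⟨w, hw, hws⟩ := exists_mem_autS_inf_autStab (F := F) (Z := P) hKS
      ⟨⟨hs.1, hPK hs⟩, hs.2⟩
    have hwA : (⟨w, hw.2⟩ : F.autStab K P hKS) ∈ (A : Subgroup _) := by
      rw [hA]
      exact mem_subgroupOf.2 hw
    refine ⟨φ ⟨w, hw.2⟩, ⟨_, hwA, rfl⟩, MulEquiv.ext fun x => Subtype.ext ?_⟩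
    exact (hws (inclusion hle x)).trans (hsb x).symm

/-- Write an isomorphism `h : Q → P` as `a ∘ θ` on `Q`, where `θ` is an arrow and `a` is the
extension to `K` of the automorphism `h θ⁻¹` of `P`. The arrow carries the extender of `h` into
`N_S(P)`, and well-placedness of `(K, P)` corrects `a` off `P` so as to extend over this image. -/
theorem WellPlaced.receptive [Fact p.Prime] [Finite S] (hS : IsPGroup p S) {K P : Subgroup G}
    (hw : F.WellPlaced p K P) (hPK : S ⊓ normalizer (P : Set G) ≤ normalizer (K : Set G))
    (hext : ∀ f, F.MapsOnto f P P → F.ExtendsTo K P f)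
    (hmax : ∀ Q, F.IsConj P Q → F.Arrow Q P) : F.Receptive P := by
  have hPS := hw.1.trans hw.2.1.1
  refine receptive_of_forall hPS fun Q h hh => ?_
  obtain ⟨θ, B, hB, hθ⟩ := hmax Q hh.isConj.symm
  have hQn := le_normIn hθ.source_le
  obtain ⟨q, hq, hqθ, -⟩ := hθ.symm
  obtain ⟨a, ha, hah⟩ := hext _ (hq.comp hh)
  have haP : F.MapsOnto a P P := (hq.comp hh).congr hah
  have haθ : ∀ x ∈ Q, a (θ x) = h x := fun x hx => by
    rw [hah _ (hθ.mem hx), Function.comp_apply, hqθ x hx]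
  obtain ⟨e, he, heh⟩ := hh
  have hXn : extender S e ≤ S ⊓ normalizer (Q : Set G) :=
    fun n hn => ((mem_extender_iff heh).1 hn).1
  have hQX : Q ≤ extender S e := fun x hx => (mem_extender_iff heh).2 ⟨hQn hx, h x,
    le_normIn hPS (heh ⟨x, hx⟩ ▸ (e ⟨x, hx⟩).2),
      fun y hy => MapsOnto.map_conj (F := F) ⟨e, he, heh⟩ hx hy⟩
  obtain ⟨N₀, hN₀, hθN⟩ := hB.restrict hXn
  have hN₀n := hθN.le_normIn hθ hQX (hXn.trans inf_le_right)
  obtain ⟨v, V, V', hv, -, hva, hN₀V, -⟩ := hw.exists_extension hS ha haP hw.1 (N₀ := N₀)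
    (fun n hn => ⟨⟨(hN₀n hn).1, hPK (hN₀n hn)⟩, (hN₀n hn).2⟩) (by
      intro n hn
      obtain ⟨m, hm, rfl⟩ := hθN.surj hn
      obtain ⟨hmn, s, hs, hsm⟩ := (mem_extender_iff heh).1 hm
      refine ⟨s, ⟨⟨hs.1, hPK hs⟩, hs.2⟩, fun x hx => ?_⟩
      obtain ⟨z, hz, rfl⟩ := hθ.surj hx
      rw [← hB.map_conj hmn (hQn hz), haθ _ ((mem_normalizer_iff.1 hmn.2 z).1 hz), haθ z hz]
      exact hsm z hz)
  obtain ⟨V₀, -, hvV⟩ := hv.restrict hN₀V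
  refine ⟨v ∘ θ, _, V₀, hθN.comp hvV, hQX, fun x hx => ?_, fun n hn s hs hns =>
    (mem_extender_iff heh).2 ⟨hn, s, hs, hns⟩⟩
  rw [Function.comp_apply, hva _ (hθ.mem hx), haθ x hx]

/-- A class outside `Δ` all of whose proper overgroups are saturated is saturated, provided that a
member `P` with the largest normalizer has `p`-automorphisms induced by `S`, normal in `Aut_F(P)`,
that are not inner. -/
theorem isSaturatedAt_of_lt_coreIn [Fact p.Prime] [Finite S] (hS : IsPGroup p S)
    {Δ : Set (Subgroup G)} (hgen : F.IsGeneratedBy Δ) {P : Subgroup G} (hP : P ≤ S)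
    (hΔ : ∀ Q, F.IsConj P Q → Q ∉ Δ)
    (hsat : ∀ Q, F.IsConj P Q → ∀ R ≤ S, Q < R → F.IsSaturatedAt p R)
    (hmax : ∀ W, F.IsConj P W → Nat.card (S ⊓ normalizer (W : Set G) : Subgroup G) ≤
      Nat.card (S ⊓ normalizer (P : Set G) : Subgroup G))
    (hlt : ¬ F.coreIn p P hP ≤ P) : F.IsSaturatedAt p P := by
  have hPK := le_coreIn (F := F) hS hP
  have hKS : F.coreIn p P hP ≤ S := coreIn_le.trans inf_le_left
  have hPn : P ≤ S ⊓ normalizer (P : Set G) := le_normIn hP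
  have hSC : ¬ F.IsConj P S := fun h => by
    obtain ⟨f, hf⟩ := h.exists_mapsOnto
    have : P = S := eq_of_le_of_card_le hP le_rfl hf.card_eq.ge
    exact hlt (this ▸ hKS.trans this.ge)
  obtain ⟨f, K, Z, hf, hfP, hw⟩ := (hsat P (mapsOnto_id hP).isConj _ hKS
    (lt_of_le_of_ne hPK fun h => hlt h.ge)).exists_wellPlaced hS hPK
  obtain ⟨u, N, B, hu, huK, huP, hN, hKN⟩ := hw.exists_extension_normalizer hS hf hfP hPK
  have hPN : S ⊓ normalizer (P : Set G) ≤ N :=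
    (le_inf (le_inf inf_le_left (normalizer_le_normalizer_coreIn hP)) inf_le_right).trans hN
  have hPZ : F.IsConj P Z := huP.isConj
  obtain ⟨B', -, hB'⟩ := hu.restrict hPN
  -- Maximality of `N_S(P)` makes `u` an isomorphism `N_S(P) → N_S(Z)`. So `Z` inherits the
  -- maximality of `P`, and `K` is all of `coreIn Z`.
  have huN := Arrow.mapsOnto_of_card_le hB' huP (hmax Z hPZ)
  have hZmax : ∀ Q, F.IsConj Z Q → F.Arrow Q Z := by
    intro Q hQ
    refine exists_arrow_of_isConj hS hgen (C := {Q | F.IsConj P Q})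
      (fun Q hQ R hR => hQ.trans hR) hΔ hSC hsat (hPZ.trans hQ) hQ.symm fun W hW => ?_
    exact (hmax W (hPZ.trans hW)).trans huN.card_eq.le
  have hZ := huP.target_le
  have hKeq : K = F.coreIn p Z hZ := by
    refine le_antisymm (huK.target_le_of_forall fun x hx =>
      (hu.mem_coreIn_iff huP (hPK.trans hKN) (hKN hx)).1 hx) fun y hy => ?_
    obtain ⟨x, hx, rfl⟩ := huN.surj (coreIn_le hy)
    exact huK.mem ((huN.mem_coreIn_iff huP hPn hx).2 hy)
  subst hKeq
  have hext : ∀ f, F.MapsOnto f Z Z → F.ExtendsTo (F.coreIn p Z hZ) Z f := fun f hf =>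
    extendsTo_coreIn hS hgen hZ (fun Q hQ => hΔ Q (hPZ.trans hQ)) hZmax (hsat Z hPZ) hf
  exact ⟨Z, hPZ, hw.fullyAutomized (normalizer_le_normalizer_coreIn hZ) hext,
    hw.receptive hS (normalizer_le_normalizer_coreIn hZ) hext hZmax⟩

end FusionSystem

/-! ### Invariant subsystems: noninner p-cores passing from `E` to `F` -/

namespace FusionSystem

variable {G : Type*} [Group G] {S T : Subgroup G} {F : FusionSystem S} {E : FusionSystem T} {p : ℕ}

theorem IsSubsystem.mapsOnto (h : E.IsSubsystem F) {f : G → G} {P Q : Subgroup G}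
    (hf : E.MapsOnto f P Q) : F.MapsOnto f P Q := by
  obtain ⟨e, he, hef⟩ := hf
  exact ⟨e, ⟨h.2 _ _ he.1, h.2 _ _ he.2⟩, hef⟩

theorem StronglyClosed.mem_iff (h : F.StronglyClosed T) {f : G → G} {P Q : Subgroup G}
    (hf : F.MapsOnto f P Q) {x : G} (hx : x ∈ P) : f x ∈ T ↔ x ∈ T := by
  obtain ⟨e, he, hef⟩ := hf
  rw [← hef ⟨x, hx⟩]
  refine ⟨fun H => ?_, fun H => h.2 _ _ _ he.1 ⟨x, hx⟩ H⟩
  have := h.2 _ _ _ he.2 (e ⟨x, hx⟩) H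
  change ((e.symm (e ⟨x, hx⟩) : P) : G) ∈ T at this
  rwa [e.symm_apply_apply] at this

theorem StronglyClosed.le_normalizer [Finite S] (h : F.StronglyClosed T) :
    S ≤ normalizer (T : Set G) := by
  intro s hs
  have : Finite T := Finite.of_injective _ (inclusion_injective h.1)
  refine mem_normalizer_of_conj_mem fun x hx => ?_
  exact (h.mem_iff (mapsOnto_conj (F := F) le_rfl hs (Subgroup.le_normalizer hs)) (h.1 hx)).2 hx

/-- Conjugation by an isomorphism of `F` maps automorphisms in an invariant subsystem `E` to
automorphisms in `E`. -/
theorem IsInvariantSubsystem.congr_mem_iso (h : E.IsInvariantSubsystem F) {P P' : Subgroup G}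
    (hP : P ≤ T) (hP' : P' ≤ T) {e : P ≃* P'} (he : e ∈ F.Iso P P') {a : MulAut P}
    (ha : a ∈ E.Iso P P) : MulAut.congr e a ∈ E.Iso P' P' := by
  -- By the Frattini condition `e` is an `E`-isomorphism `e₀` followed by a restriction `b` of some
  -- `α ∈ Aut_F(T)`. Conjugation by `e₀` stays in `E` trivially, and conjugation by `b` does so by
  -- invariance.
  obtain ⟨hEF, -, hinv, hfrat⟩ := h
  obtain ⟨α, hα, φ₀, hφ₀, hφ⟩ := hfrat P hP _
    (F.comp_mem he.1 (inclusion_mem_hom hP' hEF.1))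
  obtain ⟨P₀, hP₀, e₀, he₀, he₀', rfl⟩ := E.exists_iso hφ₀
  have heq : ∀ x : P, (e x : G) = α (inclusion hP₀ (e₀ x)) := fun x =>
    congrArg (fun ψ : P →* T => (ψ x : G)) hφ
  let b : P₀ ≃* P' := e₀.symm.trans e
  have hb : IsRestriction b.toMonoidHom α.toMonoidHom := by
    refine ⟨hP', hP₀, fun y => ?_⟩
    change (α (inclusion hP₀ y) : G) = e (e₀.symm y)
    rw [heq, e₀.apply_symm_apply]
  have key : ∀ c : MulAut P, c.toMonoidHom ∈ E.Hom P P →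
      (MulAut.congr e c).toMonoidHom ∈ E.Hom P' P' := by
    intro c hc
    have h1 := (hinv α hα P₀ P' P₀ P' b b hb hb _).1 (E.comp_mem (E.comp_mem he₀' hc) he₀)
    have h2 : (MulAut.congr e c).toMonoidHom = (b.toMonoidHom.comp
        (e₀.toMonoidHom.comp (c.toMonoidHom.comp e₀.symm.toMonoidHom))).comp
          b.symm.toMonoidHom := by
      ext y
      change (e (c (e.symm y)) : G) = e (e₀.symm (e₀ (c (e₀.symm (e₀ (e.symm y))))))
      simp
    exact h2 ▸ h1
  exact ⟨key a ha.1, key a⁻¹ ha.2⟩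

theorem IsInvariantSubsystem.congr_mem_aut_iff (h : E.IsInvariantSubsystem F) {P P' : Subgroup G}
    (hP : P ≤ T) (hP' : P' ≤ T) {e : P ≃* P'} (he : e ∈ F.Iso P P') (a : MulAut P) :
    a ∈ E.aut P hP ↔ MulAut.congr e a ∈ E.aut P' hP' := by
  refine ⟨h.congr_mem_iso hP hP' he, fun ha => ?_⟩
  have := h.congr_mem_iso hP' hP (e := e.symm) ⟨he.2, he.1⟩ ha
  have h2 : MulAut.congr e.symm (MulAut.congr e a) = a := MulEquiv.ext fun x => by
    change e.symm (e (a (e.symm (e x)))) = a x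
    simp
  exact h2 ▸ this

theorem IsInvariantSubsystem.coreAct (h : E.IsInvariantSubsystem F) {P P' : Subgroup G}
    (hP' : P' ≤ T) {f g θ : G → G} (hf : E.CoreAct p P f) (hθ : F.MapsOnto θ P P')
    (hfg : ∀ x ∈ P, g (θ x) = θ (f x)) : E.CoreAct p P' g := by
  obtain ⟨e, he, heθ⟩ := hθ
  exact hf.transport_of_equiv hP' e (fun hP => h.congr_mem_aut_iff hP hP' he) heθ hfg

theorem isNormal_normalizerSystem {Q : Subgroup G} (hQ : Q ≤ S) :
    (F.normalizerSystem Q hQ).IsNormal Q := by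
  refine ⟨le_normIn hQ, inf_le_right, ?_⟩
  rintro P R φ ⟨hP, hR, hφ, ψ, hψ, hres, α, hα⟩
  have hPQ : P ⊔ Q ≤ S ⊓ normalizer (Q : Set G) := sup_le hP (le_normIn hQ)
  have hRQ : R ⊔ Q ≤ S ⊓ normalizer (Q : Set G) := sup_le hR (le_normIn hQ)
  refine ⟨ψ, ⟨hPQ, hRQ, hψ, (inclusion le_sup_left).comp (ψ.comp (inclusion (sup_le le_rfl
    le_sup_right))), ?_, ⟨le_sup_left, le_sup_left, fun x => rfl⟩, α, ?_⟩, hres, α, hα⟩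
  · exact F.comp_mem (F.comp_mem (inclusion_mem_hom _ (hPQ.trans inf_le_left)) hψ)
      (inclusion_mem_hom _ (sup_le (hRQ.trans inf_le_left) hQ))
  · obtain ⟨h1, h2, h3⟩ := hα
    exact ⟨le_sup_right, le_sup_right, fun x => h3 x⟩

/-- If `M` is normal in `N_F(Q)`, each automorphism of `Q` in `F` extends to `QM` preserving `M`, so
`M` induces a normal `p`-subgroup of `Aut_F(Q)`. Hence `M` lies in the preimage of the `p`-core. -/
theorem isOp_normalizerSystem [Finite S] (hS : IsPGroup p S) {Q : Subgroup G} (hQ : Q ≤ S)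
    (h : F.coreIn p Q hQ ≤ Q) : (F.normalizerSystem Q hQ).IsOp Q := by
  refine ⟨isNormal_normalizerSystem hQ, fun M ⟨hM, hMn, hMext⟩ m hm => h ?_⟩
  have hMQ : M ≤ normalizer (Q : Set G) := hM.trans inf_le_right
  refine mem_coreIn_iff.2 ⟨hM hm, hQ, Q.normalizerMonoidHom ⟨m, hMQ hm⟩, ?_, fun x => rfl⟩
  refine mem_pCore_of_mem (N := (M.subgroupOf (normalizer (Q : Set G))).map
    Q.normalizerMonoidHom) ?_ ?_ ?_ ⟨⟨m, hMQ hm⟩, mem_subgroupOf.2 hm, rfl⟩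
  · rintro _ ⟨n, hn, rfl⟩
    exact mem_aut_of_mapsOnto (mapsOnto_conj hQ (hM (mem_subgroupOf.1 hn)).1 n.2) fun x => rfl
  · rintro g hg _ ⟨n, hn, rfl⟩
    have hgN : g.toMonoidHom ∈ (F.normalizerSystem Q hQ).Hom Q Q := by
      refine ⟨le_normIn hQ, le_normIn hQ, hg.1, (inclusion le_sup_left).comp
        (g.toMonoidHom.comp (inclusion (sup_le le_rfl le_rfl))), ?_,
        ⟨le_sup_left, le_sup_left, fun x => rfl⟩, g, le_sup_left, le_sup_left, fun x => rfl⟩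
      exact F.comp_mem (F.comp_mem (inclusion_mem_hom _ hQ) hg.1)
        (inclusion_mem_hom _ (sup_le hQ hQ))
    obtain ⟨ψ, -, ⟨-, h1, h2⟩, α, -, h3, h4⟩ := hMext Q Q _ hgN
    have hn' := mem_subgroupOf.1 hn
    refine ⟨⟨α ⟨n, hn'⟩, hMQ (α ⟨n, hn'⟩).2⟩, mem_subgroupOf.2 (α ⟨n, hn'⟩).2,
      MulEquiv.ext fun y => Subtype.ext ?_⟩
    obtain ⟨x, rfl⟩ := g.surjective y
    change (α ⟨n, hn'⟩ : G) * (g x : G) * (α ⟨n, hn'⟩ : G)⁻¹ =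
      g (Q.normalizerMonoidHom n (g⁻¹ (g x)))
    rw [MulAut.inv_apply_self]
    have h5 := h2 (Q.normalizerMonoidHom n x)
    have h6 : inclusion h1 (Q.normalizerMonoidHom n x) = inclusion h3 ⟨n, hn'⟩ *
        inclusion h1 x * (inclusion h3 ⟨n, hn'⟩)⁻¹ := Subtype.ext rfl
    rw [h6, map_mul, map_mul, map_inv] at h5
    have h7 := h2 x
    have h8 := h4 ⟨n, hn'⟩
    change (ψ (inclusion h3 ⟨n, hn'⟩) : G) * (ψ (inclusion h1 x) : G) *
      (ψ (inclusion h3 ⟨n, hn'⟩) : G)⁻¹ = _ at h5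
    rw [h7, h8] at h5
    exact h5
  · refine IsPGroup.map ?_ _
    rintro ⟨n, hn⟩
    obtain ⟨k, hk⟩ := hS ⟨n, (hM (mem_subgroupOf.1 hn)).1⟩
    refine ⟨k, Subtype.ext (Subtype.ext ?_)⟩
    simpa using congrArg Subtype.val hk

/-- In a saturated fusion system, a subgroup that is not centric radical has a fully automized and
receptive conjugate `Q` such that the preimage of `O_p(Aut_F(Q))` in `N_S(Q)` is not contained in
`Q`. -/
theorem exists_coreIn_not_le [Fact p.Prime] [Finite S] (hS : IsPGroup p S) (hF : F.IsSaturated p)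
    {Q : Subgroup G} (hQ : Q ≤ S) (h : Q ∉ F.centricRadical) :
    ∃ Q', ∃ hQ' : Q' ≤ S, F.IsConj Q Q' ∧ F.WellPlaced p Q' Q' ∧ ¬ F.coreIn p Q' hQ' ≤ Q' := by
  obtain ⟨Q₁, hQ₁, hconj, hcore⟩ : ∃ Q₁, ∃ hQ₁ : Q₁ ≤ S, F.IsConj Q Q₁ ∧
      ¬ F.coreIn p Q₁ hQ₁ ≤ Q₁ := by
    by_contra! H
    -- Elements centralizing `Q₁` act as the identity, so they lie in `coreIn Q₁`; its containment
    -- in `Q₁` thus yields centricity as well as the condition on `O_p`.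
    refine h ⟨⟨hQ, fun Q₁ hconj y hy => ?_⟩, fun Q₁ hQ₁ hconj _ =>
      isOp_normalizerSystem hS hQ₁ (H Q₁ hQ₁ hconj)⟩
    obtain ⟨f, hf⟩ := hconj.exists_mapsOnto
    have hyQ : ∀ x ∈ Q₁, x = y * x * y⁻¹ := fun x hx => by
      rw [← mem_centralizer_iff.1 hy.2 x hx]
      group
    have : Finite Q₁ := Finite.of_injective _ (inclusion_injective hf.target_le)
    refine H Q₁ hf.target_le hconj (mem_coreIn_iff.2 ⟨⟨hy.1, mem_normalizer_of_conj_mem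
      fun x hx => ?_⟩, hf.target_le, 1, one_mem _, fun x => hyQ x x.2⟩)
    rwa [← hyQ x hx]
  obtain ⟨f, Q', Z, hf, hfZ, hw⟩ := IsSaturatedAt.exists_wellPlaced hS (hF Q₁ hQ₁) (le_refl Q₁)
  obtain rfl := hf.target_unique hfZ
  -- A fully automized and receptive `Q'` realizes all of its `p`-core by elements of `S`, so the
  -- isomorphism `Q₁ → Q'` can be extended over `coreIn Q₁`, and noncontainment is inherited.
  obtain ⟨v, V, V', hv, hvQ, -, hV, hQV⟩ := hw.exists_extension hS hf hf le_rfl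
    (N₀ := F.coreIn p Q₁ hQ₁)
    (fun n hn => ⟨coreIn_le hn, (coreIn_le hn).2⟩) (by
      intro n hn
      obtain ⟨hn, hnc⟩ := mem_coreIn_iff.1 hn
      obtain ⟨g, hg, hgf, -⟩ := hf.symm
      have hc := (hg.comp (mapsOnto_conj hQ₁ hn.1 hn.2)).comp hf
      obtain ⟨s, hs, hsn⟩ := hw.exists_conj_of_coreAct hc hc (hnc.transport hf fun x hx => by
        simp only [Function.comp_apply]
        rw [hgf x hx])
      refine ⟨s, hs, fun x hx => ?_⟩
      have := hsn (f x) (hf.mem hx)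
      simp only [Function.comp_apply] at this
      rwa [hgf x hx] at this)
  refine ⟨Q', hf.target_le, hconj.trans hf.isConj, hw, fun hle => hcore fun y hy => ?_⟩
  exact (hv.mem_iff hvQ hQV (hV hy)).1 (hle ((hv.mem_coreIn_iff hvQ hQV (hV hy)).1 hy))

theorem StronglyClosed.mem_autStab (h : F.StronglyClosed T) {P : Subgroup G} {hP : P ≤ S}
    {a : MulAut P} (ha : a ∈ F.aut P hP) : a ∈ F.autStab P (P ⊓ T) hP := by
  obtain ⟨f, hf, hfa⟩ := exists_mapsOnto (F := F) (e := a) ha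
  refine ⟨ha, fun x => ?_⟩
  rw [hfa]
  exact ⟨fun hx => ⟨hf.mem x.2, (h.mem_iff hf x.2).2 hx.2⟩,
    fun hx => ⟨x.2, (h.mem_iff hf x.2).1 hx.2⟩⟩

/-- The automorphisms of `P` in `F` that act trivially on `P / (P ⊓ T)`, and on `P ⊓ T` as members
of `C`. -/
def autTrivialMod (F : FusionSystem S) (T : Subgroup G) {P : Subgroup G} (hP : P ≤ S)
    (C : Subgroup (MulAut (P ⊓ T : Subgroup G))) : Subgroup (MulAut P) where
  carrier := {a | a ∈ F.autRes hP inf_le_left C ∧ ∀ x : P, (x : G)⁻¹ * a x ∈ T}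
  one_mem' := ⟨one_mem _, fun x => by
    rw [MulAut.one_apply, inv_mul_cancel]
    exact one_mem _⟩
  mul_mem' := by
    rintro a b ⟨ha, ha'⟩ ⟨hb, hb'⟩
    refine ⟨mul_mem ha hb, fun x => ?_⟩
    have := mul_mem (hb' x) (ha' (b x))
    rwa [mul_assoc, mul_inv_cancel_left] at this
  inv_mem' := by
    rintro a ⟨ha, ha'⟩
    refine ⟨inv_mem ha, fun x => ?_⟩
    have := inv_mem (ha' (a⁻¹ x))
    rwa [MulAut.apply_inv_self, mul_inv_rev, inv_inv] at this

/-- Some `p`-power `d` of a given element is trivial on both `P ∩ T` and `P/(P ∩ T)`. Then `x⁻¹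
d(x)` is fixed by `d`, so `dⁿ(x) = x (x⁻¹ d(x))ⁿ`, and `n = |S|` gives the identity. -/
theorem isPGroup_autTrivialMod [Fact p.Prime] [Finite S] (hS : IsPGroup p S) {P : Subgroup G}
    (hP : P ≤ S) {C : Subgroup (MulAut (P ⊓ T : Subgroup G))} (hC : IsPGroup p C) :
    IsPGroup p (F.autTrivialMod T hP C) := by
  rintro ⟨a, ha⟩
  obtain ⟨ha₁, ha₂⟩ := mem_autRes_iff.1 ha.1
  obtain ⟨k, hk⟩ := hC ⟨_, ha₂⟩
  have hk' : F.resHom hP inf_le_left ⟨a, ha₁⟩ ^ p ^ k = 1 := congrArg Subtype.val hk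
  rw [← map_pow] at hk'
  have hd : a ^ p ^ k ∈ F.autTrivialMod T hP C := pow_mem ha _
  have hd₁ : a ^ p ^ k ∈ F.autRes hP (inf_le_left : P ⊓ T ≤ P) ⊥ :=
    mem_autRes_iff.2 ⟨pow_mem ha₁ _, mem_bot.2 hk'⟩
  set d := a ^ p ^ k with hdd
  have hfix := (mem_autRes_bot_iff (autRes_le hd₁)).1 hd₁
  have hpow : ∀ (n : ℕ) (x : P), (d ^ n) x = x * (x⁻¹ * d x) ^ n := by
    intro n x
    induction n with
    | zero => simp
    | succ n ih =>
      have hz : d (x⁻¹ * d x) = x⁻¹ * d x :=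
        Subtype.ext (hfix _ ⟨(x⁻¹ * d x).2, hd.2 x⟩ _)
      rw [pow_succ', MulAut.mul_apply, ih, map_mul, map_pow, hz, pow_succ', ← mul_assoc x,
        mul_inv_cancel_left]
  obtain ⟨m, hm⟩ := IsPGroup.iff_card.1 hS
  refine ⟨k + m, Subtype.ext ?_⟩
  change a ^ p ^ (k + m) = 1
  rw [pow_add, pow_mul, ← hdd]
  refine MulEquiv.ext fun x => ?_
  have h1 : (x⁻¹ * d x) ^ p ^ m = 1 := by
    have h2 : (⟨_, hP (x⁻¹ * d x).2⟩ : S) ^ Nat.card S = 1 := pow_card_eq_one'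
    rw [hm] at h2
    exact Subtype.ext (congrArg (fun y : S => (y : G)) h2)
  rw [hpow, h1, mul_one, MulAut.one_apply]

/-- `P` normalizes the `E`-core preimage of `P ∩ T`, which therefore has an element `k` outside `P`
normalizing `P`. Being in `T`, it acts trivially on `P/(P ∩ T)`, so it lies in the normal
`p`-subgroup `autTrivialMod` of `Aut_F(P)`. -/
theorem IsInvariantSubsystem.coreIn_not_le [Fact p.Prime] [Finite S] (hS : IsPGroup p S)
    (h : E.IsInvariantSubsystem F) {P : Subgroup G} (hP : P ≤ S)
    (hcore : ¬ E.coreIn p (P ⊓ T) inf_le_right ≤ P ⊓ T) : ¬ F.coreIn p P hP ≤ P := by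
  have hT := h.2.1
  have : Finite T := Finite.of_injective _ (inclusion_injective hT.1)
  have hET : E.coreIn p (P ⊓ T) inf_le_right ≤ T := coreIn_le.trans inf_le_left
  have : Finite (E.coreIn p (P ⊓ T) inf_le_right) :=
    Finite.of_injective _ (inclusion_injective hET)
  have hPn : P ≤ normalizer (E.coreIn p (P ⊓ T) inf_le_right : Set G) := by
    intro g hg
    have hcT := mapsOnto_conj (F := F) hT.1 (hP hg) (hT.le_normalizer (hP hg))
    have hcP := mapsOnto_conj (F := F) hP (hP hg) (Subgroup.le_normalizer hg)
    have hcZ : F.MapsOnto (fun x => g * x * g⁻¹) (P ⊓ T) (P ⊓ T) :=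
      hcP.restrict_of_mem_iff inf_le_left inf_le_left fun x hx =>
        ⟨fun hx' => ⟨hcP.mem hx, hcT.mem hx'.2⟩,
          fun hx' => ⟨hx, (hT.mem_iff hcP hx).1 hx'.2⟩⟩
    refine mem_normalizer_of_conj_mem fun y hy => ?_
    obtain ⟨hy, hyc⟩ := mem_coreIn_iff.1 hy
    refine mem_coreIn_iff.2 ⟨⟨hcT.mem hy.1, hcT.mem_normalizer hcZ inf_le_right hy.1 hy.2⟩,
      h.coreAct inf_le_right hyc hcZ fun x hx => ?_⟩
    exact (hcT.map_conj hy.1 hx.2).symm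
  obtain ⟨k, hk, hkP, hkn⟩ := exists_mem_normalizer_of_le_normalizer hS hP (hET.trans hT.1) hPn
    fun hle => hcore (le_inf hle hET)
  refine fun hle => hkP (hle ?_)
  obtain ⟨hk, hZ, b, hb, hbk⟩ := mem_coreIn_iff.1 hk
  have hkS := hT.1 hk.1
  have hkaut : P.normalizerMonoidHom ⟨k, hkn⟩ ∈ F.aut P hP :=
    mem_aut_of_mapsOnto (mapsOnto_conj hP hkS hkn) fun x => rfl
  refine mem_coreIn_iff.2 ⟨⟨hkS, hkn⟩, hP, P.normalizerMonoidHom ⟨k, hkn⟩, ?_, fun x => rfl⟩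
  refine mem_pCore_of_mem (N := F.autTrivialMod T hP (pCore p (E.aut (P ⊓ T) hZ)))
    (fun a ha => (autRes_le ha.1).1) ?_ (isPGroup_autTrivialMod hS hP (isPGroup_pCore _)) ?_
  · intro g hg a ha
    refine ⟨conj_mem_autRes (fun g hg c hc => ?_) g (hT.mem_autStab hg) a ha.1, fun x => ?_⟩
    · exact map_mem_pCore (MulAut.conj g) (h.congr_mem_aut_iff hZ hZ (e := g) hg) hc
    · obtain ⟨f, hf, hfg⟩ := exists_mapsOnto (F := F) (e := g) hg
      have h1 := ha.2 (g⁻¹ x)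
      have h2 : g ((g⁻¹ x)⁻¹ * a (g⁻¹ x)) = x⁻¹ * (g * a * g⁻¹) x := by
        rw [map_mul, map_inv, MulAut.apply_inv_self]
        rfl
      change ((x⁻¹ * (g * a * g⁻¹) x : P) : G) ∈ T
      rw [← h2, hfg]
      exact (hT.mem_iff hf (Subtype.coe_prop _)).2 h1
  · refine ⟨mem_autRes_iff.2 ⟨hT.mem_autStab hkaut, ?_⟩, fun x => ?_⟩
    · have : F.resHom hP inf_le_left ⟨_, hT.mem_autStab hkaut⟩ = b :=
        MulEquiv.ext fun z => Subtype.ext (hbk z).symm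
      exact this ▸ hb
    · change (x : G)⁻¹ * (k * x * k⁻¹) ∈ T
      have := (mem_normalizer_iff''.1 (hT.le_normalizer (hP x.2)) k).1 hk.1
      have := mul_mem this (inv_mem hk.1)
      rwa [show (x : G)⁻¹ * k * x * k⁻¹ = (x : G)⁻¹ * (k * x * k⁻¹) by group] at this

/-- `a * (n + 1) + b` encodes the lexicographic order on pairs whose second entry is at most `n`. -/
theorem le_of_lex {n a b a' b' : ℕ} (h : a * (n + 1) + b ≤ a' * (n + 1) + b') (hb : b' ≤ n) :
    a ≤ a' := by
  by_contra! hlt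
  have := Nat.mul_le_mul_right (n + 1) hlt
  rw [Nat.succ_mul] at this
  omega

/-- If `P` has a largest normalizer in its conjugacy class, and the normalizer of `P ⊓ T` in `T` is
largest subject to this, then some conjugate of `P` with a largest normalizer acquires from `E`
noninner automorphisms in `O_p(Aut_F(P))`. -/
theorem IsInvariantSubsystem.exists_coreIn_not_le [Fact p.Prime] [Finite S] (hS : IsPGroup p S)
    (h : E.IsInvariantSubsystem F) (hE : E.IsSaturated p) {P : Subgroup G} (hP : P ≤ S)
    (hcr : P ⊓ T ∉ E.centricRadical)
    (hsat : ∀ R ≤ T, Nat.card (P ⊓ T : Subgroup G) < Nat.card R → F.IsSaturatedAt p R)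
    (hmax : ∀ W, F.IsConj P W → Nat.card (S ⊓ normalizer (P : Set G) : Subgroup G) ≤
        Nat.card (S ⊓ normalizer (W : Set G) : Subgroup G) →
      Nat.card (T ⊓ normalizer ((W ⊓ T : Subgroup G) : Set G) : Subgroup G) ≤
        Nat.card (T ⊓ normalizer ((P ⊓ T : Subgroup G) : Set G) : Subgroup G)) :
    ∃ W, ∃ hW : W ≤ S, F.Arrow P W ∧ ¬ F.coreIn p W hW ≤ W := by
  have hEF := h.1
  have hT := h.2.1
  have : Finite T := Finite.of_injective _ (inclusion_injective hT.1)
  have hTp : IsPGroup p T := hS.to_le hT.1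
  have hPT : F.MapsOnto id (P ⊓ T) (P ⊓ T) := mapsOnto_id (inf_le_left.trans hP)
  set Q := P ⊓ T with hQdef
  have hQT : Q ≤ T := inf_le_right
  obtain ⟨Q', hQ'T, hQQ', hwE, hcore⟩ := FusionSystem.exists_coreIn_not_le hTp hE hQT hcr
  -- `N_T(Q)` is a saturated class, and it embeds into `N_T(Q')`
  obtain ⟨c, hc⟩ := hQQ'.exists_mapsOnto
  obtain ⟨φ, N, B, hφ, hφQ, -, hN, hQN⟩ :=
    hwE.exists_extension_normalizer hTp hc hc le_rfl
  obtain ⟨N', -, hφN⟩ := hφ.restrict (P' := T ⊓ normalizer (Q : Set G))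
    ((le_inf le_rfl inf_le_right).trans hN)
  have hN' : N' ≤ T ⊓ normalizer (Q' : Set G) :=
    hφN.le_normIn hφQ (le_normIn hQT) inf_le_right
  have hQltT : Q < T := by
    refine lt_of_le_of_ne hQT fun heq => hcore ?_
    have : Q' = T := eq_of_le_of_card_le hQ'T le_rfl (by rw [← hφQ.card_eq, heq])
    exact (coreIn_le.trans inf_le_left).trans this.ge
  have hQlt := exists_normalizing_restriction hTp le_rfl hQltT
  obtain ⟨c₁, R, Z, hc₁, hc₁Z, hw⟩ := (hsat _ inf_le_left
    (card_lt_card_of_lt hQlt (S := T) inf_le_left)).exists_wellPlaced hS hQlt.le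
  obtain ⟨u, M, B₁, hu, huR, huZ, hM, hNM⟩ := hw.exists_extension_normalizer hS hc₁ hc₁Z hQlt.le
  -- `N_S(Q)` normalizes `N_T(Q)`, so `u` is defined on `N_S(Q)`, hence on `N_S(P)`, which
  -- normalizes `Q = P ∩ T`. In particular `u` restricts to an arrow from `P`.
  have hSQ : S ⊓ normalizer (Q : Set G) ≤ M := by
    intro s hs
    have : Finite (T ⊓ normalizer (Q : Set G) : Subgroup G) :=
      Finite.of_injective _ (inclusion_injective inf_le_left)
    refine hM ⟨⟨hs.1, mem_normalizer_of_conj_mem fun t ht => ⟨?_, ?_⟩⟩, hs.2⟩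
    · exact (mem_normalizer_iff.1 (hT.le_normalizer hs.1) t).1 ht.1
    · exact (normalizer (Q : Set G)).mul_mem ((normalizer (Q : Set G)).mul_mem hs.2 ht.2)
        ((normalizer (Q : Set G)).inv_mem hs.2)
  have hSP : S ⊓ normalizer (P : Set G) ≤ S ⊓ normalizer (Q : Set G) := fun s hs =>
    ⟨hs.1, mem_normalizer_iff.2 fun x => and_congr (mem_normalizer_iff.1 hs.2 x)
      (mem_normalizer_iff.1 (hT.le_normalizer hs.1) x)⟩
  have hPM : P ≤ M := (le_normIn hP).trans (hSP.trans hSQ)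
  obtain ⟨W, hW, huW⟩ := hu.restrict hPM
  have hPW : F.Arrow P W := hu.arrow (hSP.trans hSQ) huW
  have hZW : Z = W ⊓ T := by
    refine huZ.target_unique (huW.restrict_of_mem_iff inf_le_left inf_le_left fun x hx => ?_)
    exact ⟨fun hx' => ⟨huW.mem hx, (hT.mem_iff huW hx).2 hx'.2⟩,
      fun hx' => ⟨hx, (hT.mem_iff huW hx).1 hx'.2⟩⟩
  -- The second maximality condition bounds `|N_T(Z)|` by `|N_T(Q)| = |R|`, which forces `R =
  -- N_T(Z)`.
  have hcW := hmax W hPW.isConj hPW.card_le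
  rw [← hZW, huR.card_eq] at hcW
  have hRZ : R ≤ T ⊓ normalizer (Z : Set G) := huR.target_le_of_forall fun x hx =>
    ⟨(hT.mem_iff huR hx).2 hx.1, huR.mem_normalizer huZ hQlt.le hx hx.2⟩
  have hReq : R = T ⊓ normalizer (Z : Set G) :=
    eq_of_le_of_card_le (S := T) hRZ inf_le_left hcW
  -- transport along an isomorphism `N_T(Q') → N_T(Z)`
  have hφF := hEF.mapsOnto hφN
  have hφQF := hEF.mapsOnto hφQ
  obtain ⟨ψ, hψ, hψφ, -⟩ := hφF.symm
  have hψQ := hφF.symm_restrict hφQF (le_normIn hQT) hψ hψφ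
  have hQ'N : Q' ≤ N' := hφQ.target_le_of_forall fun x hx => hφN.mem (le_normIn hQT hx)
  obtain ⟨v, V, V', hv, hvR, hvZ, hV, -⟩ :=
    hw.exists_extension_normalizer hS (hψ.comp huR) (hψQ.comp huZ) hQ'N
  -- Otherwise `v` would embed a strictly larger subgroup of `N_T(Q')` into `N_T(Z) = R`, although
  -- `|R| = |N'|`.
  have hN'eq : N' = T ⊓ normalizer (Q' : Set G) := by
    by_contra hne
    have hlt := lt_normalizer_inf hTp (lt_of_le_of_ne hN' hne)
    obtain ⟨D, -, hD⟩ := hv.restrict (P' := T ⊓ normalizer (N' : Set G) ⊓ normalizer (Q' : Set G))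
      ((inf_le_inf_right _ (inf_le_inf_right _ hT.1)).trans hV)
    have hDR : D ≤ R := by
      rw [hReq]
      exact hD.target_le_of_forall fun x hx => ⟨(hT.mem_iff hD hx).2 hx.1.1,
        hD.mem_normalizer hvZ (hQ'N.trans hlt.le) hx hx.2⟩
    have h1 := card_lt_card_of_lt hlt (S := T) (inf_le_left.trans inf_le_left)
    have h2 := card_le_card_of_le hDR hvR.target_le
    rw [← hD.card_eq, ← hvR.card_eq] at h2
    omega
  have hZT : Z ≤ T := hZW ▸ inf_le_right
  have hcoreZ : ¬ E.coreIn p Z hZT ≤ Z := by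
    refine fun hle => hcore fun y hy => ?_
    obtain ⟨hyn, hyc⟩ := mem_coreIn_iff.1 hy
    have hyN : y ∈ N' := hN'eq ▸ hyn
    refine (hvR.mem_iff hvZ hQ'N hyN).1 (hle (mem_coreIn_iff.2 ⟨hReq ▸ hvR.mem hyN,
      h.coreAct hZT hyc hvZ fun x hx => ?_⟩))
    exact (hvR.map_conj hyN (hQ'N hx)).symm
  subst hZW
  exact ⟨W, huW.target_le, hPW, h.coreIn_not_le hS huW.target_le hcoreZ⟩

theorem StronglyClosed.card_inf_eq (h : F.StronglyClosed T) {f : G → G} {P Q : Subgroup G}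
    (hf : F.MapsOnto f P Q) : Nat.card (P ⊓ T : Subgroup G) = Nat.card (Q ⊓ T : Subgroup G) :=
  (hf.restrict_of_mem_iff inf_le_left inf_le_left fun _ hx =>
    ⟨fun hx' => ⟨hf.mem hx, (h.mem_iff hf hx).2 hx'.2⟩,
      fun hx' => ⟨hx, (h.mem_iff hf hx).1 hx'.2⟩⟩).card_eq

end FusionSystem

/-! ### The maximal counterexample -/

open FusionSystem

theorem theorem1 {p : ℕ} [Fact p.Prime] {G : Type*} [Group G]
    (S : Subgroup G) [Finite S] (hS : IsPGroup p S) (F : FusionSystem S)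
    (T : Subgroup G) (E : FusionSystem T)
    (hEF : E.IsInvariantSubsystem F) (hE : E.IsSaturated p)
    (Δ : Set (Subgroup G)) (hΔ : F.IsClosedSet Δ)
    (hgen : F.IsGeneratedBy Δ) (hsat : F.IsSaturatedOn p Δ)
    (hcr : E.centricRadical ⊆ Δ) :
    F.IsSaturated p := by
  by_contra hns
  have hex : ∃ P, P ≤ S ∧ ¬ F.IsSaturatedAt p P := by
    by_contra! H
    exact hns H
  have hT := hEF.2.1
  have hcard : ∀ {P : Subgroup G}, P ≤ S → Nat.card P ≤ Nat.card S := fun hP =>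
    card_le_card_of_le hP le_rfl
  -- Lexicographic maximality of `(|P ∩ T|, |P|)`; the factor `|S| + 1` exceeds every second entry.
  obtain ⟨P₀, ⟨hP₀, hP₀s⟩, hP₀max⟩ := exists_forall_le_of_bdd hex
    (fun P => Nat.card (P ⊓ T : Subgroup G) * (Nat.card S + 1) + Nat.card P)
    (Nat.card S * (Nat.card S + 1) + Nat.card S) fun P hP =>
      add_le_add (Nat.mul_le_mul_right _ (hcard (inf_le_left.trans hP.1))) (hcard hP.1)
  -- Within the class, `(|N_S(P)|, |N_T(P ∩ T)|)` is made lexicographically largest.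
  obtain ⟨P, hP₀P, hPmax⟩ := exists_forall_le_of_bdd (q := fun P => F.IsConj P₀ P)
    ⟨P₀, (mapsOnto_id hP₀).isConj⟩
    (fun P => Nat.card (S ⊓ normalizer (P : Set G) : Subgroup G) * (Nat.card S + 1) +
      Nat.card (T ⊓ normalizer ((P ⊓ T : Subgroup G) : Set G) : Subgroup G))
    (Nat.card S * (Nat.card S + 1) + Nat.card S) fun P _ =>
      add_le_add (Nat.mul_le_mul_right _ (hcard inf_le_left)) (hcard (inf_le_left.trans hT.1))
  have hPsat : ¬ F.IsSaturatedAt p P := fun h => hP₀s (h.of_isConj hP₀P.symm)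
  have hsatT : ∀ {W : Subgroup G}, F.IsConj P₀ W → ∀ R ≤ S,
      Nat.card (W ⊓ T : Subgroup G) * (Nat.card S + 1) + Nat.card W <
        Nat.card (R ⊓ T : Subgroup G) * (Nat.card S + 1) + Nat.card R →
      F.IsSaturatedAt p R := by
    intro W hW R hR hlt
    by_contra hRs
    have := hP₀max R ⟨hR, hRs⟩
    obtain ⟨f, hf⟩ := hW.exists_mapsOnto
    rw [hT.card_inf_eq hf, hf.card_eq] at this
    omega
  obtain ⟨f, hf⟩ := hP₀P.exists_mapsOnto
  have hP : P ≤ S := hf.target_le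
  have hΔP : ∀ Q, F.IsConj P Q → Q ∉ Δ := fun Q hQ hQΔ =>
    hPsat (IsSaturatedAt.of_isConj (hsat Q hQΔ) hQ.symm)
  have hmaxS : ∀ W, F.IsConj P W → Nat.card (S ⊓ normalizer (W : Set G) : Subgroup G) ≤
      Nat.card (S ⊓ normalizer (P : Set G) : Subgroup G) := fun W hW =>
    le_of_lex (hPmax W (hP₀P.trans hW)) (hcard (inf_le_left.trans hT.1))
  obtain ⟨W, hW, hPW, hcore⟩ := hEF.exists_coreIn_not_le hS hE hP
    -- If `P ∩ T` were in `E^{cr}`, it would be in `Δ`, and so would its overgroup `P`.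
    (fun hmem => hΔP P (mapsOnto_id hP).isConj (hΔ.2.2 _ (hcr hmem) P inf_le_left hP))
    (fun R hR hlt => by
      refine hsatT hP₀P R (hR.trans hT.1) ?_
      by_contra! hle
      rw [inf_eq_left.2 hR] at hle
      exact absurd (le_of_lex hle (hcard hP)) (not_le.2 hlt))
    (fun W hW hcW => by
      have h1 := hPmax W (hP₀P.trans hW)
      rw [le_antisymm (hmaxS W hW) hcW] at h1
      exact Nat.le_of_add_le_add_left h1)
  refine hPsat (IsSaturatedAt.of_isConj ?_ hPW.isConj.symm)
  refine isSaturatedAt_of_lt_coreIn hS hgen hW (fun Q hQ => hΔP Q (hPW.isConj.trans hQ))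
    (fun Q hQ R hR hlt => hsatT (hP₀P.trans (hPW.isConj.trans hQ)) R hR ?_)
    (fun V hV => (hmaxS V (hPW.isConj.trans hV)).trans hPW.card_le) hcore
  exact add_lt_add_of_le_of_lt (Nat.mul_le_mul_right _ (card_le_card_of_le
    (inf_le_inf_right T hlt.le) (inf_le_left.trans hR))) (card_lt_card_of_lt hlt hR)
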